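/- All vector spaces and algebras are over $\mathbb C$. Let $\mathfrak g$ be a Lie superalgebra and let $\theta$ be an involution of $\mathfrak g$, that is, an even automorphism with $\theta\circ\theta=\mathrm{id}$. Write $\mathfrak g=\mathfrak k\oplus\mathfrak p$, where $\mathfrak k$ and $\mathfrak p$ are the eigenspaces of $\theta$ for the eigenvalues $1$ and $-1$. Let $\mathfrak h\subseteq\mathfrak g_{\bar 0}$ be a subalgebra such that: (i) $\theta(\mathfrak h)=\mathfrak h$, so that $\mathfrak h=\mathfrak t\oplus\mathfrak a$ with $\mathfrak t=\mathfrak h\cap\mathfrak k$ and $\mathfrak a=\mathfrak h\cap\mathfrak p$; (ii) the operators $\mathrm{ad}_x$, $x\in\mathfrak h$, on $\mathfrak g$ are simultaneously diagonalizable; (iii) $C_{\mathfrak g}(\mathfrak h)=\mathfrak h$ and $C_{\mathfrak p}(\mathfrak a)=\mathfrak a$, where $C_{\mathfrak b}(\mathfrak a)=\{x\in\mathfrak b : [x,y]=0 \text{ for all } y\in\mathfrak a\}$. Let $U(\mathfrak g)$ be the universal enveloping algebra, with the coproduct $\Delta$ (an algebra homomorphism to the super tensor product $U(\mathfrak g)\otimes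 U(\mathfrak g)$) and the counit determined by $\Delta(x)=x\otimes 1+1\otimes x$ and $\varepsilon(x)=0$ for $x\in\mathfrak g$. The dual $U(\mathfrak g)^*$ is an associative algebra with unit $\varepsilon$ and product $(\varphi\psi)(x)=\sum(-1)^{|x_1||\psi|}\varphi(x_1)\psi(x_2)$, where $\Delta(x)=\sum x_1\otimes x_2$. Put $\mathcal I_L=U(\mathfrak g)\mathfrak k$ and $\mathcal I=\mathfrak kU(\mathfrak g)+U(\mathfrak g)\mathfrak k$, and let $\mathcal A(\mathfrak g,\mathfrak k)\subseteq U(\mathfrak g)^*$ be the subalgebra of functionals which vanish on $\mathcal I$; they are regarded as functionals on $U(\mathfrak g)/\mathcal I$. The symmetric algebra $S(\mathfrak a)$ is a Hopf algebra in which the elements of $\mathfrak a$ are primitive, and $S(\mathfrak a)^*$ is its dual algebra. Let $\bar{\mathsf s}:S(\mathfrak a)\to U(\mathfrak g)/\mathcal I_L$ be the linear map $$x_1\cdots x_r\mapsto \frac1{r!}\sum_{\pi\in S_r}x_{\pi(1)}\cdots x_{\pi(r)}+\mathcal I_L\qquad(x_1,\dots,x_r\in\mathfrak a)$$ and let $\mathsf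 q:U(\mathfrak g)/\mathcal I_L\to U(\mathfrak g)/\mathcal I$ be the quotient map. A linear functional on an algebra $H$ is of finite type if its kernel contains a two-sided ideal of $H$ of finite codimension. Let $U(\mathfrak g)^\circ\subseteq U(\mathfrak g)^*$ and $S(\mathfrak a)^\circ\subseteq S(\mathfrak a)^*$ be the subalgebras of functionals of finite type, and put $\mathcal A(\mathfrak g,\mathfrak k)^\circ=\mathcal A(\mathfrak g,\mathfrak k)\cap U(\mathfrak g)^\circ$. Then the algebra $\mathcal A(\mathfrak g,\mathfrak k)$ is commutative, and the map $(\mathsf q\circ\bar{\mathsf s})^*:\mathcal A(\mathfrak g,\mathfrak k)\to S(\mathfrak a)^*$, $\lambda\mapsto\lambda\circ\mathsf q\circ\bar{\mathsf s}$, is an injective homomorphism of (commutative) algebras. It restricts to an injective algebra homomorphism $\mathcal A(\mathfrak g,\mathfrak k)^\circ\to S(\mathfrak a)^\circ$. -/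

import Mathlib

open scoped TensorProduct DirectSum

noncomputable section

/-- The sign `(-1) ^ i` of a parity `i`, as a complex number. -/
def superSign (i : ZMod 2) : ℂ := if i = 0 then 1 else -1

theorem parity_cases (i : ZMod 2) : i = 0 ∨ i = 1 := by
  revert i; decide

theorem superSign_zero : superSign 0 = 1 := by simp [superSign]

theorem superSign_one : superSign 1 = -1 := by simp [superSign]

theorem superSign_add (i j : ZMod 2) : superSign (i + j) = superSign i * superSign j := by
  have h : (1 + 1 : ZMod 2) = 0 := by decide
  rcases parity_cases i with rfl | rfl <;> rcases parity_cases j with rfl | rfl <;>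
    simp [superSign_zero, superSign_one, h]

theorem superSign_mul_self (i : ZMod 2) : superSign i * superSign i = 1 := by
  rcases parity_cases i with rfl | rfl <;> simp [superSign_zero, superSign_one]

theorem superSign_units_smul {M : Type*} [AddCommGroup M] [Module ℂ M] (i : ZMod 2) (m : M) :
    ((-1 : ℤˣ) ^ i) • m = superSign i • m := by
  rcases parity_cases i with rfl | rfl
  · rw [uzpow_zero, superSign_zero, one_smul, one_smul]
  · rw [uzpow_one, superSign_one]; simp

/-- A Lie superalgebra over `ℂ`: a `ZMod 2`-graded space with an even bilinear bracket which is
super skew-symmetric and satisfies the super Jacobi identity. -/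
class LieSuperalgebra (L : Type*) [AddCommGroup L] [Module ℂ L] where
  /-- the homogeneous parts: `part 0` is the even part, `part 1` the odd part -/
  part : ZMod 2 → Submodule ℂ L
  isInternal : DirectSum.IsInternal part
  /-- the superbracket -/
  bracket : L →ₗ[ℂ] L →ₗ[ℂ] L
  bracket_mem : ∀ (i j : ZMod 2) (x y : L), x ∈ part i → y ∈ part j → bracket x y ∈ part (i + j)
  skew : ∀ (i j : ZMod 2) (x y : L), x ∈ part i → y ∈ part j →
    bracket x y = -(superSign (i * j) • bracket y x)
  jacobi : ∀ (i j : ZMod 2) (x y z : L), x ∈ part i → y ∈ part j →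
    bracket x (bracket y z) =
      bracket (bracket x y) z + superSign (i * j) • bracket y (bracket x z)

namespace LieSuperalgebra

variable (L : Type*) [AddCommGroup L] [Module ℂ L] [LieSuperalgebra L]

instance decomposition : DirectSum.Decomposition (part (L := L)) :=
  isInternal.chooseDecomposition

/-- The projection onto the homogeneous part of parity `i`. -/
def proj (i : ZMod 2) : L →ₗ[ℂ] L :=
  (part i).subtype ∘ₗ DirectSum.component ℂ (ZMod 2) (fun j => part (L := L) j) i ∘ₗ
    (DirectSum.decomposeLinearEquiv (part (L := L))).toLinearMap

variable {L}

theorem proj_apply (i : ZMod 2) (x : L) :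
    proj L i x = (DirectSum.decompose (part (L := L)) x i : L) := rfl

theorem proj_mem (i : ZMod 2) (x : L) : proj L i x ∈ part i := by
  rw [proj_apply]; exact SetLike.coe_mem _

theorem proj_same {i : ZMod 2} {x : L} (hx : x ∈ part i) : proj L i x = x := by
  rw [proj_apply]; exact DirectSum.decompose_of_mem_same _ hx

theorem proj_ne {i j : ZMod 2} {x : L} (hx : x ∈ part i) (h : i ≠ j) : proj L j x = 0 := by
  rw [proj_apply]; exact DirectSum.decompose_of_mem_ne _ hx h

theorem hom_induction {p : L → Prop} (x : L)
    (h : ∀ i, ∀ x ∈ part (L := L) i, p x)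
    (hadd : ∀ x y, p x → p y → p (x + y)) : p x := by
  have hx : x ∈ ⨆ i, part (L := L) i := by
    rw [(isInternal (L := L)).submodule_iSup_eq_top]; trivial
  exact Submodule.iSup_induction (motive := p) (part (L := L)) hx h (h 0 0 (zero_mem _)) hadd

theorem proj_add_proj (x : L) : proj L 0 x + proj L 1 x = x := by
  refine hom_induction (p := fun x => proj L 0 x + proj L 1 x = x) x (fun i x hx => ?_) (fun x y hx hy => ?_)
  · rcases parity_cases i with rfl | rfl
    · rw [proj_same hx, proj_ne hx (by decide), add_zero]
    · rw [proj_same hx, proj_ne hx (by decide), zero_add]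
  · rw [map_add, map_add, add_add_add_comm, hx, hy]

/-- The linear map which acts on the homogeneous part of parity `j` by `(-1) ^ (i * j)`. -/
def twist (i : ZMod 2) : L →ₗ[ℂ] L := proj L 0 + superSign i • proj L 1

theorem twist_apply {i j : ZMod 2} {x : L} (hx : x ∈ part j) :
    twist i x = superSign (i * j) • x := by
  rcases parity_cases j with rfl | rfl
  · simp [twist, proj_same hx, proj_ne hx (show (0 : ZMod 2) ≠ 1 by decide), superSign_zero]
  · simp [twist, proj_same hx, proj_ne hx (show (1 : ZMod 2) ≠ 0 by decide)]

end LieSuperalgebra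

open LieSuperalgebra

section Enveloping

variable (L : Type*) [AddCommGroup L] [Module ℂ L] [LieSuperalgebra L]

/-- The defining relations `x y - (-1) ^ (|x| |y|) y x = [x, y]`, for homogeneous `x` and `y`, of
the universal enveloping algebra of a Lie superalgebra. -/
inductive SuperEnveloping.Rel : TensorAlgebra ℂ L → TensorAlgebra ℂ L → Prop
  | bracket (i j : ZMod 2) (x y : L) (hx : x ∈ part i) (hy : y ∈ part j) :
      SuperEnveloping.Rel
        (TensorAlgebra.ι ℂ x * TensorAlgebra.ι ℂ y -
          superSign (i * j) • (TensorAlgebra.ι ℂ y * TensorAlgebra.ι ℂ x))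
        (TensorAlgebra.ι ℂ (bracket x y))

/-- The universal enveloping algebra `U(L)` of a Lie superalgebra `L`. -/
def SuperEnveloping : Type _ := RingQuot (SuperEnveloping.Rel L)

namespace SuperEnveloping

instance : Ring (SuperEnveloping L) := inferInstanceAs (Ring (RingQuot (Rel L)))

instance : Algebra ℂ (SuperEnveloping L) := inferInstanceAs (Algebra ℂ (RingQuot (Rel L)))

/-- The quotient map from the tensor algebra. -/
def mkAlgHom : TensorAlgebra ℂ L →ₐ[ℂ] SuperEnveloping L := RingQuot.mkAlgHom ℂ (Rel L)

/-- The canonical map `L → U(L)`. -/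
def ι : L →ₗ[ℂ] SuperEnveloping L := (mkAlgHom L).toLinearMap ∘ₗ TensorAlgebra.ι ℂ

variable {L}

theorem ι_mul_ι {i j : ZMod 2} {x y : L} (hx : x ∈ part i) (hy : y ∈ part j) :
    ι L x * ι L y - superSign (i * j) • (ι L y * ι L x) = ι L (bracket x y) := by
  have := RingQuot.mkAlgHom_rel ℂ (Rel.bracket i j x y hx hy)
  simp only [map_sub, map_mul, map_smul] at this
  exact this

/-- The universal property of the enveloping algebra. -/
def lift {A : Type*} [Ring A] [Algebra ℂ A] (f : L →ₗ[ℂ] A)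
    (hf : ∀ (i j : ZMod 2) (x y : L), x ∈ part i → y ∈ part j →
      f x * f y - superSign (i * j) • (f y * f x) = f (bracket x y)) :
    SuperEnveloping L →ₐ[ℂ] A :=
  RingQuot.liftAlgHom ℂ ⟨TensorAlgebra.lift ℂ f, by
    rintro _ _ ⟨i, j, x, y, hx, hy⟩
    simpa using hf i j x y hx hy⟩

theorem lift_ι {A : Type*} [Ring A] [Algebra ℂ A] (f : L →ₗ[ℂ] A)
    (hf : ∀ (i j : ZMod 2) (x y : L), x ∈ part i → y ∈ part j →
      f x * f y - superSign (i * j) • (f y * f x) = f (bracket x y)) (x : L) :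
    lift f hf (ι L x) = f x := by
  have h : lift f hf (ι L x) = TensorAlgebra.lift ℂ f (TensorAlgebra.ι ℂ x) :=
    RingQuot.liftAlgHom_mkAlgHom_apply ..
  rw [h, TensorAlgebra.lift_ι_apply]

theorem hom_ext {A : Type*} [Ring A] [Algebra ℂ A] {f g : SuperEnveloping L →ₐ[ℂ] A}
    (h : ∀ x, f (ι L x) = g (ι L x)) : f = g := by
  apply RingQuot.ringQuot_ext'
  apply TensorAlgebra.hom_ext
  ext x
  exact h x

theorem adjoin_ι : Algebra.adjoin ℂ (Set.range (ι L)) = ⊤ := by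
  have hs : Function.Surjective (mkAlgHom L) := RingQuot.mkAlgHom_surjective ℂ (Rel L)
  have h1 : (⊤ : Subalgebra ℂ (SuperEnveloping L)) =
      (⊤ : Subalgebra ℂ (TensorAlgebra ℂ L)).map (mkAlgHom L) := by
    rw [Algebra.map_top, (AlgHom.range_eq_top _).mpr hs]
  rw [h1, ← TensorAlgebra.adjoin_range_ι, AlgHom.map_adjoin, ← Set.range_comp]
  rfl

/-- `U(L)` is spanned by the elements obtained from `1` by left multiplications by homogeneous
elements of `L`. -/
theorem induction_left (p : Submodule ℂ (SuperEnveloping L)) (h1 : 1 ∈ p)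
    (h : ∀ (i : ZMod 2) (x : L), x ∈ part i → ∀ u ∈ p, ι L x * u ∈ p) (u : SuperEnveloping L) :
    u ∈ p := by
  have key : ∀ v ∈ Algebra.adjoin ℂ (Set.range (ι L)), ∀ u ∈ p, v * u ∈ p := by
    intro v hv
    induction hv using Algebra.adjoin_induction with
    | mem v hv =>
      obtain ⟨x, rfl⟩ := hv
      intro u hu
      refine hom_induction (p := fun x => ι L x * u ∈ p) x (fun i x hx => h i x hx u hu) ?_
      intro x y hx hy
      rw [map_add, add_mul]
      exact add_mem hx hy
    | algebraMap r =>
      intro u hu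
      rw [← Algebra.smul_def]
      exact p.smul_mem r hu
    | add v w _ _ hv hw =>
      intro u hu
      rw [add_mul]
      exact add_mem (hv u hu) (hw u hu)
    | mul v w _ _ hv hw =>
      intro u hu
      rw [mul_assoc]
      exact hv _ (hw u hu)
  have := key u (by rw [adjoin_ι]; trivial) 1 h1
  rwa [mul_one] at this

variable (L)

/-- The automorphism of `U(L)` which acts on the part of parity `j` by `(-1) ^ (i * j)`. -/
def twist (i : ZMod 2) : SuperEnveloping L →ₐ[ℂ] SuperEnveloping L :=
  lift (ι L ∘ₗ LieSuperalgebra.twist i) (by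
    intro j k x y hx hy
    have hb := bracket_mem j k x y hx hy
    simp only [LinearMap.comp_apply, LieSuperalgebra.twist_apply hx,
      LieSuperalgebra.twist_apply hy, LieSuperalgebra.twist_apply hb, map_smul, mul_add,
      superSign_add, ← ι_mul_ι hx hy]
    simp only [smul_mul_assoc, mul_smul_comm, smul_sub, smul_smul]
    congr 2 <;> ring)

variable {L}

theorem twist_ι {i j : ZMod 2} {x : L} (hx : x ∈ part j) :
    twist L i (ι L x) = superSign (i * j) • ι L x := by
  rw [twist, lift_ι, LinearMap.comp_apply, LieSuperalgebra.twist_apply hx, map_smul]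

theorem hom_ext' {A : Type*} [Ring A] [Algebra ℂ A] {f g : SuperEnveloping L →ₐ[ℂ] A}
    (h : ∀ i, ∀ x ∈ part (L := L) i, f (ι L x) = g (ι L x)) : f = g := by
  refine hom_ext fun x => hom_induction (p := fun x => f (ι L x) = g (ι L x)) x h ?_
  intro x y hx hy
  rw [map_add, map_add, map_add, hx, hy]

theorem twist_zero : twist L 0 = AlgHom.id ℂ _ := by
  refine hom_ext' fun i x hx => ?_
  rw [twist_ι hx, zero_mul, superSign_zero, one_smul]; rfl

theorem twist_twist (i j : ZMod 2) (u : SuperEnveloping L) :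
    twist L i (twist L j u) = twist L (i + j) u := by
  have : (twist L i).comp (twist L j) = twist L (i + j) := by
    refine hom_ext' fun k x hx => ?_
    rw [AlgHom.comp_apply, twist_ι hx, map_smul, twist_ι hx, twist_ι hx, smul_smul, add_mul,
      superSign_add, mul_comm]
  exact congrArg (fun f => f u) this

variable (L)

/-- The `ZMod 2`-grading of `U(L)` induced by the grading of `L`: the unique algebra grading for
which homogeneous elements of `L` keep their parity, given as the eigenspaces of the parity
automorphism `twist L 1`, which sends a homogeneous `x` in `L` to `(-1) ^ |x| x`. -/
def grading (i : ZMod 2) : Submodule ℂ (SuperEnveloping L) :=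
  LinearMap.ker ((twist L 1).toLinearMap - superSign i • LinearMap.id)

variable {L}

theorem mem_grading {i : ZMod 2} {u : SuperEnveloping L} :
    u ∈ grading L i ↔ twist L 1 u = superSign i • u := by
  simp [grading, sub_eq_zero]

theorem twist_apply {i j : ZMod 2} {u : SuperEnveloping L} (hu : u ∈ grading L j) :
    twist L i u = superSign (i * j) • u := by
  rcases parity_cases i with rfl | rfl
  · rw [twist_zero, zero_mul, superSign_zero, one_smul]; rfl
  · rw [mem_grading.mp hu, one_mul]

theorem ι_mem_grading {i : ZMod 2} {x : L} (hx : x ∈ part i) : ι L x ∈ grading L i := by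
  rw [mem_grading, twist_ι hx, one_mul]

instance : SetLike.GradedMonoid (grading L) where
  one_mem := by rw [mem_grading, map_one, superSign_zero, one_smul]
  mul_mem i j u v hu hv := by
    rw [mem_grading] at *
    rw [map_mul, hu, hv, superSign_add, smul_mul_smul_comm]

theorem half_mem (i : ZMod 2) (u : SuperEnveloping L) :
    (2⁻¹ : ℂ) • (u + superSign i • twist L 1 u) ∈ grading L i := by
  have h : twist L 1 (twist L 1 u) = u := by
    rw [twist_twist, show (1 + 1 : ZMod 2) = 0 by decide, twist_zero]; rfl
  rw [mem_grading, map_smul, map_add, map_smul, h, smul_comm, smul_add (superSign i), smul_smul (superSign i),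
    superSign_mul_self, one_smul, add_comm]

theorem grading_isInternal : DirectSum.IsInternal (grading L) := by
  rw [DirectSum.isInternal_submodule_iff_isCompl (grading L) (zero_ne_one (α := ZMod 2))
    (by ext i; simpa using parity_cases i)]
  constructor
  · rw [Submodule.disjoint_def]
    intro u h0 h1
    rw [mem_grading] at h0 h1
    rw [h0, superSign_zero, superSign_one, one_smul, neg_smul, one_smul] at h1
    have h2 : (2 : ℂ) • u = 0 := by
      rw [two_smul]
      nth_rewrite 2 [h1]
      exact add_neg_cancel u
    exact (smul_eq_zero.mp h2).resolve_left two_ne_zero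
  · rw [codisjoint_iff_le_sup]
    intro u _
    have h : u = (2⁻¹ : ℂ) • (u + superSign 0 • twist L 1 u) +
        (2⁻¹ : ℂ) • (u + superSign 1 • twist L 1 u) := by
      rw [superSign_zero, superSign_one]
      module
    rw [h]
    exact Submodule.add_mem_sup (half_mem 0 u) (half_mem 1 u)

instance : GradedAlgebra (grading L) where
  toDecomposition := grading_isInternal.chooseDecomposition

theorem grading_induction {p : SuperEnveloping L → Prop} (u : SuperEnveloping L)
    (h : ∀ i, ∀ u ∈ grading L i, p u) (hadd : ∀ u v, p u → p v → p (u + v)) : p u := by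
  have hu : u ∈ ⨆ i, grading L i := by
    rw [grading_isInternal.submodule_iSup_eq_top]; trivial
  exact Submodule.iSup_induction (motive := p) (grading L) hu h (h 0 0 (zero_mem _)) hadd

/-- The projection of `U(L)` onto its homogeneous part of parity `i`. -/
def proj (i : ZMod 2) : SuperEnveloping L →ₗ[ℂ] SuperEnveloping L :=
  (grading L i).subtype ∘ₗ DirectSum.component ℂ (ZMod 2) (fun j => grading L j) i ∘ₗ
    (DirectSum.decomposeLinearEquiv (grading L)).toLinearMap

theorem proj_apply (i : ZMod 2) (u : SuperEnveloping L) :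
    proj i u = (DirectSum.decompose (grading L) u i : SuperEnveloping L) := rfl

theorem proj_same {i : ZMod 2} {u : SuperEnveloping L} (hu : u ∈ grading L i) : proj i u = u := by
  rw [proj_apply]; exact DirectSum.decompose_of_mem_same _ hu

theorem proj_ne {i j : ZMod 2} {u : SuperEnveloping L} (hu : u ∈ grading L i) (h : i ≠ j) :
    proj j u = 0 := by
  rw [proj_apply]; exact DirectSum.decompose_of_mem_ne _ hu h

open GradedTensorProduct

variable (L)

/-- The coproduct of the Hopf superalgebra `U(L)`: the algebra homomorphism to the super tensor
product `U(L) ⊗ U(L)` with `Δ x = x ⊗ 1 + 1 ⊗ x` for `x` in `L`. -/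
def comul : SuperEnveloping L →ₐ[ℂ] (grading L ᵍ⊗[ℂ] grading L) :=
  lift ((includeLeft (grading L) (grading L)).toLinearMap ∘ₗ ι L +
      (includeRight (grading L) (grading L)).toLinearMap ∘ₗ ι L) (by
    intro i j x y hx hy
    have cross : ∀ {i j : ZMod 2} {x y : L}, x ∈ part i → y ∈ part j →
        includeRight (grading L) (grading L) (ι L x) * includeLeft (grading L) (grading L) (ι L y)
        = superSign (i * j) • (includeLeft (grading L) (grading L) (ι L y) *
          includeRight (grading L) (grading L) (ι L x)) := by
      intro i j x y hx hy
      have h := tmul_coe_mul_coe_tmul (R := ℂ) (grading L) (grading L) 1 ⟨_, ι_mem_grading hx⟩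
        ⟨_, ι_mem_grading hy⟩ 1
      rw [superSign_units_smul, one_mul, mul_one] at h
      rw [includeRight_apply, includeLeft_apply, tmul_one_mul_one_tmul]
      exact h
    simp only [LinearMap.add_apply, LinearMap.comp_apply, AlgHom.toLinearMap_apply]
    rw [← ι_mul_ι hx hy]
    simp only [map_sub, map_mul, map_smul, add_mul, mul_add]
    rw [cross hx hy, cross hy hx, smul_add, smul_add, smul_add, smul_smul, mul_comm j i,
      superSign_mul_self, one_smul]
    abel)

/-- The counit of `U(L)`: the algebra homomorphism which vanishes on `L`. -/
def counit : SuperEnveloping L →ₐ[ℂ] ℂ := lift 0 (by simp)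

variable {L}

theorem comul_ι (x : L) :
    comul L (ι L x) = (ι L x) ᵍ⊗ₜ[ℂ] 1 + 1 ᵍ⊗ₜ[ℂ] (ι L x) := by
  rw [comul, lift_ι]; rfl

theorem counit_ι (x : L) : counit L (ι L x) = 0 := by
  rw [counit, lift_ι]; rfl

/-- The functional on `U(L) ⊗ U(L)` given by two functionals `φ` and `ψ` according to the sign
rule: `x₁ ⊗ x₂ ↦ (-1) ^ (|x₁| |ψ|) φ x₁ * ψ x₂` for homogeneous `x₁` and `ψ`. The component of
parity `j` of `ψ` is `ψ ∘ proj j`. -/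
def superPairing (φ ψ : SuperEnveloping L →ₗ[ℂ] ℂ) :
    (grading L ᵍ⊗[ℂ] grading L) →ₗ[ℂ] ℂ :=
  (∑ i : ZMod 2, ∑ j : ZMod 2, superSign (i * j) •
    (LinearMap.mul' ℂ ℂ ∘ₗ TensorProduct.map (φ ∘ₗ proj i) (ψ ∘ₗ proj j))) ∘ₗ
    (of ℂ (grading L) (grading L)).symm.toLinearMap

theorem superPairing_tmul (φ ψ : SuperEnveloping L →ₗ[ℂ] ℂ) {i : ZMod 2}
    {u v : SuperEnveloping L} (hu : u ∈ grading L i) :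
    superPairing φ ψ (u ᵍ⊗ₜ[ℂ] v) = φ u * ψ (twist L i v) := by
  refine grading_induction (p := fun v =>
    superPairing φ ψ (u ᵍ⊗ₜ[ℂ] v) = φ u * ψ (twist L i v)) v (fun j v hv => ?_) ?_
  · rw [twist_apply hv]
    simp only [superPairing, LinearMap.comp_apply, LinearMap.sum_apply, LinearMap.smul_apply,
      LinearEquiv.coe_coe, of_symm_of, TensorProduct.map_tmul, LinearMap.mul'_apply]
    rw [Finset.sum_eq_single i, Finset.sum_eq_single j]
    · rw [proj_same hu, proj_same hv, map_smul, smul_eq_mul, smul_eq_mul]; ring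
    · intro k _ hk
      rw [proj_ne hv hk.symm, map_zero, mul_zero, smul_zero]
    · simp
    · intro k _ hk
      simp [proj_ne hu hk.symm]
    · simp
  · intro v w hv hw
    rw [tmul, TensorProduct.tmul_add, map_add, map_add, hv, hw, map_add, map_add, mul_add]

/-- Two functionals on the super tensor square agree if they agree on homogeneous tensors. -/
theorem tensor_ext {M : Type*} [AddCommGroup M] [Module ℂ M]
    {f g : (grading L ᵍ⊗[ℂ] grading L) →ₗ[ℂ] M}
    (h : ∀ (i j : ZMod 2) (u v : SuperEnveloping L), u ∈ grading L i → v ∈ grading L j →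
      f (u ᵍ⊗ₜ[ℂ] v) = g (u ᵍ⊗ₜ[ℂ] v)) : f = g := by
  apply GradedTensorProduct.hom_ext
  apply TensorProduct.ext'
  intro u v
  refine grading_induction (p := fun u => (f ∘ₗ (of ℂ (grading L) (grading L)).toLinearMap) (u ⊗ₜ v) =
    (g ∘ₗ (of ℂ (grading L) (grading L)).toLinearMap) (u ⊗ₜ v)) u (fun i u hu => ?_) ?_
  · refine grading_induction (p := fun v => (f ∘ₗ (of ℂ (grading L) (grading L)).toLinearMap) (u ⊗ₜ v) =
      (g ∘ₗ (of ℂ (grading L) (grading L)).toLinearMap) (u ⊗ₜ v)) v (fun j v hv => h i j u v hu hv) ?_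
    intro v w hv hw
    rw [TensorProduct.tmul_add, map_add, map_add, hv, hw]
  · intro v w hv hw
    rw [TensorProduct.add_tmul, map_add, map_add, hv, hw]

/-- The product of two functionals on `U(L)`:
`(φ ψ)(x) = ∑ (-1) ^ (|x₁| |ψ|) φ x₁ * ψ x₂`, where `Δ x = ∑ x₁ ⊗ x₂`. -/
def dualMul (φ ψ : SuperEnveloping L →ₗ[ℂ] ℂ) : SuperEnveloping L →ₗ[ℂ] ℂ :=
  superPairing φ ψ ∘ₗ (comul L).toLinearMap

theorem superPairing_add_left (φ φ' ψ : SuperEnveloping L →ₗ[ℂ] ℂ) :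
    superPairing (φ + φ') ψ = superPairing φ ψ + superPairing φ' ψ := by
  refine tensor_ext fun i j u v hu hv => ?_
  simp only [superPairing_tmul _ _ hu, LinearMap.add_apply, add_mul]

theorem superPairing_add_right (φ ψ ψ' : SuperEnveloping L →ₗ[ℂ] ℂ) :
    superPairing φ (ψ + ψ') = superPairing φ ψ + superPairing φ ψ' := by
  refine tensor_ext fun i j u v hu hv => ?_
  simp only [superPairing_tmul _ _ hu, LinearMap.add_apply, mul_add]

theorem superPairing_smul_left (c : ℂ) (φ ψ : SuperEnveloping L →ₗ[ℂ] ℂ) :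
    superPairing (c • φ) ψ = c • superPairing φ ψ := by
  refine tensor_ext fun i j u v hu hv => ?_
  simp only [superPairing_tmul _ _ hu, LinearMap.smul_apply, smul_eq_mul, mul_assoc]

theorem superPairing_smul_right (c : ℂ) (φ ψ : SuperEnveloping L →ₗ[ℂ] ℂ) :
    superPairing φ (c • ψ) = c • superPairing φ ψ := by
  refine tensor_ext fun i j u v hu hv => ?_
  simp only [superPairing_tmul _ _ hu, LinearMap.smul_apply, smul_eq_mul]
  ring

theorem dualMul_add_left (φ φ' ψ : SuperEnveloping L →ₗ[ℂ] ℂ) :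
    dualMul (φ + φ') ψ = dualMul φ ψ + dualMul φ' ψ := by
  rw [dualMul, superPairing_add_left, LinearMap.add_comp]; rfl

theorem dualMul_add_right (φ ψ ψ' : SuperEnveloping L →ₗ[ℂ] ℂ) :
    dualMul φ (ψ + ψ') = dualMul φ ψ + dualMul φ ψ' := by
  rw [dualMul, superPairing_add_right, LinearMap.add_comp]; rfl

theorem dualMul_smul_left (c : ℂ) (φ ψ : SuperEnveloping L →ₗ[ℂ] ℂ) :
    dualMul (c • φ) ψ = c • dualMul φ ψ := by
  rw [dualMul, superPairing_smul_left, LinearMap.smul_comp]; rfl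

theorem dualMul_smul_right (c : ℂ) (φ ψ : SuperEnveloping L →ₗ[ℂ] ℂ) :
    dualMul φ (c • ψ) = c • dualMul φ ψ := by
  rw [dualMul, superPairing_smul_right, LinearMap.smul_comp]; rfl

theorem dualMul_zero_left (ψ : SuperEnveloping L →ₗ[ℂ] ℂ) : dualMul 0 ψ = 0 := by
  simpa using dualMul_smul_left 0 0 ψ

theorem dualMul_zero_right (φ : SuperEnveloping L →ₗ[ℂ] ℂ) : dualMul φ 0 = 0 := by
  simpa using dualMul_smul_right 0 φ 0

theorem dualMul_one (φ ψ : SuperEnveloping L →ₗ[ℂ] ℂ) : dualMul φ ψ 1 = φ 1 * ψ 1 := by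
  have h : dualMul φ ψ 1 = superPairing φ ψ (1 ᵍ⊗ₜ[ℂ] 1) := by
    rw [dualMul, LinearMap.comp_apply, AlgHom.toLinearMap_apply, map_one]; rfl
  rw [h, superPairing_tmul φ ψ (SetLike.GradedOne.one_mem), map_one (twist L 0)]

/-- The functional `u ↦ φ (v u)`. -/
def leftTr (v : SuperEnveloping L) (φ : SuperEnveloping L →ₗ[ℂ] ℂ) : SuperEnveloping L →ₗ[ℂ] ℂ :=
  φ ∘ₗ LinearMap.mulLeft ℂ v

/-- The functional `u ↦ φ (u v)`. -/
def rightTr (v : SuperEnveloping L) (φ : SuperEnveloping L →ₗ[ℂ] ℂ) :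
    SuperEnveloping L →ₗ[ℂ] ℂ :=
  φ ∘ₗ LinearMap.mulRight ℂ v

/-- The functional `u ↦ φ (twist i u)`. -/
def twistDual (i : ZMod 2) (φ : SuperEnveloping L →ₗ[ℂ] ℂ) : SuperEnveloping L →ₗ[ℂ] ℂ :=
  φ ∘ₗ (twist L i).toLinearMap

theorem leftTr_apply (v u : SuperEnveloping L) (φ : SuperEnveloping L →ₗ[ℂ] ℂ) :
    leftTr v φ u = φ (v * u) := rfl

theorem rightTr_apply (v u : SuperEnveloping L) (φ : SuperEnveloping L →ₗ[ℂ] ℂ) :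
    rightTr v φ u = φ (u * v) := rfl

theorem twistDual_apply (i : ZMod 2) (u : SuperEnveloping L) (φ : SuperEnveloping L →ₗ[ℂ] ℂ) :
    twistDual i φ u = φ (twist L i u) := rfl

theorem comul_ι_mul (x : L) (u : SuperEnveloping L) :
    comul L (ι L x * u) = (ι L x) ᵍ⊗ₜ[ℂ] 1 * comul L u + 1 ᵍ⊗ₜ[ℂ] (ι L x) * comul L u := by
  rw [map_mul, comul_ι, add_mul]

theorem comul_mul_ι (x : L) (u : SuperEnveloping L) :
    comul L (u * ι L x) = comul L u * (ι L x) ᵍ⊗ₜ[ℂ] 1 + comul L u * 1 ᵍ⊗ₜ[ℂ] (ι L x) := by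
  rw [map_mul, comul_ι, mul_add]

theorem tmul_mul_tmul {j k : ZMod 2} (a b c d : SuperEnveloping L) (hb : b ∈ grading L j)
    (hc : c ∈ grading L k) :
    ((a ᵍ⊗ₜ[ℂ] b) * (c ᵍ⊗ₜ[ℂ] d) : grading L ᵍ⊗[ℂ] grading L) =
      superSign (j * k) • ((a * c) ᵍ⊗ₜ[ℂ] (b * d)) := by
  have h := tmul_coe_mul_coe_tmul (R := ℂ) (grading L) (grading L) a ⟨b, hb⟩ ⟨c, hc⟩ d
  rwa [superSign_units_smul] at h

theorem one_mem_grading : (1 : SuperEnveloping L) ∈ grading L 0 := SetLike.GradedOne.one_mem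

theorem mul_mem_grading {i j : ZMod 2} {u v : SuperEnveloping L} (hu : u ∈ grading L i)
    (hv : v ∈ grading L j) : u * v ∈ grading L (i + j) := SetLike.GradedMul.mul_mem hu hv

theorem leftTr_dualMul {k : ZMod 2} {x : L} (hx : x ∈ part k)
    (φ ψ : SuperEnveloping L →ₗ[ℂ] ℂ) :
    leftTr (ι L x) (dualMul φ ψ) =
      dualMul (leftTr (ι L x) φ) (twistDual k ψ) + dualMul φ (leftTr (ι L x) ψ) := by
  have h1 : superPairing φ ψ ∘ₗ LinearMap.mulLeft ℂ ((ι L x) ᵍ⊗ₜ[ℂ] 1) =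
      superPairing (leftTr (ι L x) φ) (twistDual k ψ) := by
    refine tensor_ext fun i j u v hu hv => ?_
    have hx' := ι_mem_grading hx
    rw [LinearMap.comp_apply, LinearMap.mulLeft_apply, tmul_mul_tmul _ _ _ _ one_mem_grading hu,
      zero_mul, superSign_zero, one_smul, one_mul, superPairing_tmul _ _ (mul_mem_grading hx' hu),
      superPairing_tmul _ _ hu, leftTr_apply, twistDual_apply, twist_twist]
  have h2 : superPairing φ ψ ∘ₗ LinearMap.mulLeft ℂ (1 ᵍ⊗ₜ[ℂ] (ι L x)) =
      superPairing φ (leftTr (ι L x) ψ) := by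
    refine tensor_ext fun i j u v hu hv => ?_
    have hx' := ι_mem_grading hx
    rw [LinearMap.comp_apply, LinearMap.mulLeft_apply, tmul_mul_tmul _ _ _ _ hx' hu,
      one_mul, map_smul, superPairing_tmul _ _ hu,
      superPairing_tmul _ _ hu, leftTr_apply, map_mul, twist_ι hx, smul_mul_assoc, map_smul,
      smul_eq_mul, smul_eq_mul, mul_comm k i, mul_left_comm, ← mul_assoc, ← mul_assoc,
      mul_assoc (φ u), superSign_mul_self, mul_one]
  ext u
  rw [leftTr_apply, LinearMap.add_apply, dualMul, LinearMap.comp_apply, AlgHom.toLinearMap_apply,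
    comul_ι_mul, map_add]
  exact congrArg₂ (· + ·) (LinearMap.congr_fun h1 _) (LinearMap.congr_fun h2 _)

theorem rightTr_dualMul {k : ZMod 2} {x : L} (hx : x ∈ part k)
    (φ ψ : SuperEnveloping L →ₗ[ℂ] ℂ) :
    rightTr (ι L x) (dualMul φ ψ) =
      dualMul (rightTr (ι L x) φ) ψ + dualMul (twistDual k φ) (rightTr (ι L x) ψ) := by
  have hx' := ι_mem_grading hx
  have h1 : superPairing φ ψ ∘ₗ LinearMap.mulRight ℂ ((ι L x) ᵍ⊗ₜ[ℂ] 1) =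
      superPairing (rightTr (ι L x) φ) ψ := by
    refine tensor_ext fun i j u v hu hv => ?_
    rw [LinearMap.comp_apply, LinearMap.mulRight_apply, tmul_mul_tmul _ _ _ _ hv hx', mul_one,
      map_smul, superPairing_tmul _ _ (mul_mem_grading hu hx'),
      superPairing_tmul _ _ hu, rightTr_apply, twist_apply hv, twist_apply hv, map_smul, map_smul,
      add_mul, superSign_add, mul_comm k j]
    simp only [smul_eq_mul]
    linear_combination (φ (u * ι L x)) * superSign (i * j) * ψ v * superSign_mul_self (j * k)
  have h2 : superPairing φ ψ ∘ₗ LinearMap.mulRight ℂ (1 ᵍ⊗ₜ[ℂ] (ι L x)) =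
      superPairing (twistDual k φ) (rightTr (ι L x) ψ) := by
    refine tensor_ext fun i j u v hu hv => ?_
    rw [LinearMap.comp_apply, LinearMap.mulRight_apply, tmul_mul_tmul _ _ _ _ hv one_mem_grading,
      mul_zero, superSign_zero, one_smul, mul_one, superPairing_tmul _ _ hu,
      superPairing_tmul _ _ hu, rightTr_apply, twistDual_apply, map_mul, twist_ι hx,
      twist_apply hu, mul_smul_comm, map_smul, map_smul, mul_comm k i]
    simp only [smul_eq_mul]
    ring
  ext u
  rw [rightTr_apply, LinearMap.add_apply, dualMul, LinearMap.comp_apply, AlgHom.toLinearMap_apply,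
    comul_mul_ι, map_add]
  exact congrArg₂ (· + ·) (LinearMap.congr_fun h1 _) (LinearMap.congr_fun h2 _)

theorem twistDual_twistDual (i j : ZMod 2) (φ : SuperEnveloping L →ₗ[ℂ] ℂ) :
    twistDual i (twistDual j φ) = twistDual (i + j) φ := by
  ext u
  simp only [twistDual_apply, twist_twist, add_comm]

theorem leftTr_twistDual {k : ZMod 2} {x : L} (hx : x ∈ part k) (i : ZMod 2)
    (φ : SuperEnveloping L →ₗ[ℂ] ℂ) :
    leftTr (ι L x) (twistDual i φ) = superSign (i * k) • twistDual i (leftTr (ι L x) φ) := by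
  ext u
  rw [leftTr_apply, twistDual_apply, map_mul, twist_ι hx, smul_mul_assoc, map_smul]
  rfl

/-- An equality of functionals can be checked through left translations. -/
theorem dual_induction {T : Type*} (F G : T → (SuperEnveloping L →ₗ[ℂ] ℂ))
    (h1 : ∀ t, F t 1 = G t 1)
    (h : ∀ (u : SuperEnveloping L), (∀ t, F t u = G t u) →
      ∀ (k : ZMod 2) (x : L), x ∈ part k → ∀ t, F t (ι L x * u) = G t (ι L x * u)) (t : T) :
    F t = G t := by
  have key : ∀ u, u ∈ ⨅ t, LinearMap.ker (F t - G t) := by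
    apply induction_left
    · simp only [Submodule.mem_iInf, LinearMap.mem_ker, LinearMap.sub_apply, sub_eq_zero]
      exact h1
    · intro k x hx u hu
      simp only [Submodule.mem_iInf, LinearMap.mem_ker, LinearMap.sub_apply, sub_eq_zero] at hu ⊢
      exact h u hu k x hx
  ext u
  have := key u
  simp only [Submodule.mem_iInf, LinearMap.mem_ker, LinearMap.sub_apply, sub_eq_zero] at this
  exact this t

theorem twistDual_dualMul (i : ZMod 2) (φ ψ : SuperEnveloping L →ₗ[ℂ] ℂ) :
    twistDual i (dualMul φ ψ) = dualMul (twistDual i φ) (twistDual i ψ) := by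
  refine dual_induction
    (T := (SuperEnveloping L →ₗ[ℂ] ℂ) × (SuperEnveloping L →ₗ[ℂ] ℂ))
    (fun t => twistDual i (dualMul t.1 t.2))
    (fun t => dualMul (twistDual i t.1) (twistDual i t.2)) ?_ ?_ (φ, ψ)
  · rintro ⟨φ, ψ⟩
    simp only [twistDual_apply, dualMul_one, map_one]
  · rintro u hu k x hx ⟨φ, ψ⟩
    simp only [← leftTr_apply]
    rw [leftTr_twistDual hx, leftTr_dualMul hx, leftTr_dualMul hx, leftTr_twistDual hx,
      leftTr_twistDual hx, dualMul_smul_left, dualMul_smul_right, twistDual_twistDual, add_comm k i,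
      ← twistDual_twistDual i k, ← smul_add]
    have h1 := hu (leftTr (ι L x) φ, twistDual k ψ)
    have h2 := hu (φ, leftTr (ι L x) ψ)
    simp only [LinearMap.smul_apply, LinearMap.add_apply] at h1 h2 ⊢
    rw [← h1, ← h2]
    rfl

theorem dualMul_assoc (φ ψ χ : SuperEnveloping L →ₗ[ℂ] ℂ) :
    dualMul (dualMul φ ψ) χ = dualMul φ (dualMul ψ χ) := by
  refine dual_induction
    (T := (SuperEnveloping L →ₗ[ℂ] ℂ) × (SuperEnveloping L →ₗ[ℂ] ℂ) × (SuperEnveloping L →ₗ[ℂ] ℂ))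
    (fun t => dualMul (dualMul t.1 t.2.1) t.2.2)
    (fun t => dualMul t.1 (dualMul t.2.1 t.2.2)) ?_ ?_ (φ, ψ, χ)
  · rintro ⟨φ, ψ, χ⟩
    simp only [dualMul_one, mul_assoc]
  · rintro u hu k x hx ⟨φ, ψ, χ⟩
    simp only [← leftTr_apply]
    simp only [leftTr_dualMul hx, dualMul_add_left, dualMul_add_right, twistDual_dualMul]
    have h1 := hu (leftTr (ι L x) φ, twistDual k ψ, twistDual k χ)
    have h2 := hu (φ, leftTr (ι L x) ψ, twistDual k χ)
    have h3 := hu (φ, ψ, leftTr (ι L x) χ)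
    simp only [LinearMap.add_apply] at h1 h2 h3 ⊢
    rw [h1, h2, h3, add_assoc]

theorem leftTr_counit (x : L) : leftTr (ι L x) (counit L).toLinearMap = 0 := by
  ext u
  rw [leftTr_apply, AlgHom.toLinearMap_apply, map_mul, counit_ι, zero_mul]; rfl

theorem counit_dualMul (φ : SuperEnveloping L →ₗ[ℂ] ℂ) :
    dualMul (counit L).toLinearMap φ = φ := by
  refine dual_induction (fun φ => dualMul (counit L).toLinearMap φ) (fun φ => φ) ?_ ?_ φ
  · intro φ
    rw [dualMul_one, AlgHom.toLinearMap_apply, map_one, one_mul]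
  · intro u hu k x hx φ
    rw [← leftTr_apply, leftTr_dualMul hx, leftTr_counit, dualMul_zero_left, zero_add, hu]
    rfl

theorem twistDual_counit (i : ZMod 2) :
    twistDual i (counit L).toLinearMap = (counit L).toLinearMap := by
  have : (counit L).comp (twist L i) = counit L := by
    refine hom_ext' fun k x hx => ?_
    rw [AlgHom.comp_apply, twist_ι hx, map_smul, counit_ι, smul_zero]
  ext u
  exact congrArg (fun f => f u) this

theorem dualMul_counit (φ : SuperEnveloping L →ₗ[ℂ] ℂ) :
    dualMul φ (counit L).toLinearMap = φ := by
  refine dual_induction (fun φ => dualMul φ (counit L).toLinearMap) (fun φ => φ) ?_ ?_ φ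
  · intro φ
    rw [dualMul_one, AlgHom.toLinearMap_apply, map_one (counit L), mul_one]
  · intro u hu k x hx φ
    rw [← leftTr_apply, leftTr_dualMul hx, leftTr_counit, dualMul_zero_right, add_zero,
      twistDual_counit, hu]
    rfl

open WithConv

/-- The dual `U(L)^*` with its algebra structure dual to the coalgebra structure of `U(L)`. As in
the ungraded case, `WithConv` marks the functionals which are multiplied by convolution. -/
instance : Ring (WithConv (SuperEnveloping L →ₗ[ℂ] ℂ)) where
  __ := (inferInstance : AddCommGroup (WithConv (SuperEnveloping L →ₗ[ℂ] ℂ)))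
  mul φ ψ := toConv (dualMul φ.ofConv ψ.ofConv)
  one := toConv (counit L).toLinearMap
  mul_assoc φ ψ χ := congrArg toConv (dualMul_assoc _ _ _)
  one_mul φ := congrArg toConv (counit_dualMul _)
  mul_one φ := congrArg toConv (dualMul_counit _)
  zero_mul φ := congrArg toConv (dualMul_zero_left _)
  mul_zero φ := congrArg toConv (dualMul_zero_right _)
  left_distrib φ ψ χ := congrArg toConv (dualMul_add_right _ _ _)
  right_distrib φ ψ χ := congrArg toConv (dualMul_add_left _ _ _)

theorem dual_mul_def (φ ψ : WithConv (SuperEnveloping L →ₗ[ℂ] ℂ)) :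
    φ * ψ = toConv (dualMul φ.ofConv ψ.ofConv) := rfl

theorem dual_one_def :
    (1 : WithConv (SuperEnveloping L →ₗ[ℂ] ℂ)) = toConv (counit L).toLinearMap := rfl

instance : Algebra ℂ (WithConv (SuperEnveloping L →ₗ[ℂ] ℂ)) :=
  .ofModule (fun c _ _ => congrArg toConv (dualMul_smul_left c _ _))
    (fun c _ _ => congrArg toConv (dualMul_smul_right c _ _))

end SuperEnveloping

end Enveloping

section FiniteType

variable {H : Type*} [Ring H] [Algebra ℂ H]

/-- A linear functional on an algebra `H` is of finite type if its kernel contains a two-sided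
ideal of `H` of finite codimension. -/
def IsFiniteType (φ : H →ₗ[ℂ] ℂ) : Prop :=
  ∃ I : Ideal H, I.IsTwoSided ∧ FiniteDimensional ℂ (H ⧸ I) ∧ ∀ x ∈ I, φ x = 0

theorem finite_quot_ker {M P : Type*} [AddCommGroup M] [Module ℂ M] [AddCommGroup P] [Module ℂ P]
    [FiniteDimensional ℂ P] (T : M →ₗ[ℂ] P) : FiniteDimensional ℂ (M ⧸ LinearMap.ker T) :=
  Module.Finite.equiv T.quotKerEquivRange.symm

theorem finite_quot_ker_end {M P : Type*} [AddCommGroup M] [Module ℂ M] [AddCommGroup P]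
    [Module ℂ P] [FiniteDimensional ℂ P] (T : M →ₗ[ℂ] (P →ₗ[ℂ] P)) :
    FiniteDimensional ℂ (M ⧸ LinearMap.ker T) :=
  finite_quot_ker T

/-- A functional is of finite type iff it lies in a finite-dimensional space of functionals which
is stable under translations. -/
theorem isFiniteType_iff (φ : H →ₗ[ℂ] ℂ) :
    IsFiniteType φ ↔ ∃ N : Submodule ℂ (H →ₗ[ℂ] ℂ), N.FG ∧ φ ∈ N ∧
      ∀ v : H, ∀ ψ ∈ N, ψ ∘ₗ LinearMap.mulLeft ℂ v ∈ N := by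
  constructor
  · rintro ⟨I, hI, hfin, hφ⟩
    let W : Submodule ℂ H := I.restrictScalars ℂ
    have hW : FiniteDimensional ℂ (H ⧸ W) := hfin
    refine ⟨W.dualAnnihilator, ?_, ?_, ?_⟩
    · rw [← Submodule.fg_top, ← Module.finite_def]
      exact Module.Finite.equiv W.dualQuotEquivDualAnnihilator
    · rw [Submodule.mem_dualAnnihilator]
      exact hφ
    · intro v ψ hψ
      rw [Submodule.mem_dualAnnihilator] at hψ ⊢
      intro x hx
      exact hψ _ (I.mul_mem_left v hx)
  · rintro ⟨N, hN, hφ, hst⟩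
    have hfin : FiniteDimensional ℂ N := Module.Finite.iff_fg.mpr hN
    obtain ⟨T, hT⟩ : ∃ T : H →ₗ[ℂ] (N →ₗ[ℂ] N), ∀ v (ψ : N) u, (T v ψ).1 u = ψ.1 (v * u) :=
      ⟨LinearMap.mk₂ ℂ
      (fun v ψ => (⟨ψ.1 ∘ₗ LinearMap.mulLeft ℂ v, hst v ψ.1 ψ.2⟩ : N))
      (by intro v w ψ; ext u; simp [add_mul])
      (by intro c v ψ; ext u; simp)
      (by intro v ψ χ; ext u; simp)
      (by intro c v ψ; ext u; simp), fun _ _ _ => rfl⟩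
    have hT0 : ∀ v, T v = 0 ↔ ∀ (ψ : N) u, ψ.1 (v * u) = 0 := by
      intro v
      constructor
      · intro h ψ u
        rw [← hT, h]; rfl
      · intro h
        ext ψ u
        rw [hT]
        exact h ψ u
    let I : Ideal H :=
      { carrier := {v | T v = 0}
        add_mem' := fun {v w} hv hw => by
          change T (v + w) = 0
          rw [map_add, show T v = 0 from hv, show T w = 0 from hw, add_zero]
        zero_mem' := map_zero T
        smul_mem' := fun v w hw => (hT0 _).mpr fun ψ u => by
          rw [smul_eq_mul, mul_assoc]
          exact (hT0 _).mp hw ⟨_, hst v ψ.1 ψ.2⟩ u }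
    refine ⟨I, ⟨fun {a} b ha => (hT0 _).mpr fun ψ u => ?_⟩, ?_, fun x hx => ?_⟩
    · rw [mul_assoc]
      exact (hT0 _).mp ha ψ (b * u)
    · have hIT : I.restrictScalars ℂ = LinearMap.ker T := rfl
      have h2 : FiniteDimensional ℂ (H ⧸ I.restrictScalars ℂ) := by
        rw [hIT]
        exact finite_quot_ker_end (P := N) T
      exact h2
    · have := (hT0 _).mp hx ⟨φ, hφ⟩ 1
      rwa [mul_one] at this

theorem IsFiniteType.add {φ ψ : H →ₗ[ℂ] ℂ} (hφ : IsFiniteType φ) (hψ : IsFiniteType ψ) :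
    IsFiniteType (φ + ψ) := by
  rw [isFiniteType_iff] at *
  obtain ⟨N, hN, h1, h2⟩ := hφ
  obtain ⟨M, hM, h3, h4⟩ := hψ
  refine ⟨N ⊔ M, hN.sup hM, add_mem (Submodule.mem_sup_left h1) (Submodule.mem_sup_right h3), ?_⟩
  intro v χ hχ
  obtain ⟨a, ha, b, hb, rfl⟩ := Submodule.mem_sup.mp hχ
  rw [LinearMap.add_comp]
  exact add_mem (Submodule.mem_sup_left (h2 v a ha)) (Submodule.mem_sup_right (h4 v b hb))

theorem isFiniteType_smul_algHom (c : ℂ) (ε : H →ₐ[ℂ] ℂ) : IsFiniteType (c • ε.toLinearMap) := by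
  rw [isFiniteType_iff]
  refine ⟨Submodule.span ℂ {ε.toLinearMap}, Submodule.fg_span_singleton _,
    Submodule.smul_mem _ _ (Submodule.mem_span_singleton_self _), ?_⟩
  intro v χ hχ
  obtain ⟨d, rfl⟩ := Submodule.mem_span_singleton.mp hχ
  rw [Submodule.mem_span_singleton]
  refine ⟨d * ε v, ?_⟩
  ext u
  simp [mul_assoc]

end FiniteType

section FiniteDual

open WithConv

/-- The algebra `H° ⊆ H^*` of functionals of finite type on a commutative bialgebra `H`. -/
def finiteDual (H : Type*) [CommRing H] [Bialgebra ℂ H] :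
    Subalgebra ℂ (WithConv (H →ₗ[ℂ] ℂ)) where
  carrier := {φ | IsFiniteType φ.ofConv}
  add_mem' hφ hψ := IsFiniteType.add hφ hψ
  algebraMap_mem' c := by
    have := isFiniteType_smul_algHom c (Bialgebra.counitAlgHom ℂ H)
    exact this
  mul_mem' := by
    rintro φ ψ ⟨I, _, hI, hφ⟩ ⟨J, _, hJ, hψ⟩
    let F : H →ₐ[ℂ] (H ⧸ I) ⊗[ℂ] (H ⧸ J) :=
      (Algebra.TensorProduct.map (Ideal.Quotient.mkₐ ℂ I) (Ideal.Quotient.mkₐ ℂ J)).comp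
        (Bialgebra.comulAlgHom ℂ H)
    refine ⟨RingHom.ker F, inferInstance, ?_, ?_⟩
    · exact finite_quot_ker F.toLinearMap
    · intro x hx
      let φ' : (H ⧸ I) →ₗ[ℂ] ℂ := Submodule.liftQ (I.restrictScalars ℂ) φ.ofConv hφ
      let ψ' : (H ⧸ J) →ₗ[ℂ] ℂ := Submodule.liftQ (J.restrictScalars ℂ) ψ.ofConv hψ
      have h1 : ∀ t : H ⊗[ℂ] H, LinearMap.mul' ℂ ℂ (TensorProduct.map φ.ofConv ψ.ofConv t) =
          LinearMap.mul' ℂ ℂ (TensorProduct.map φ' ψ' (Algebra.TensorProduct.map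
            (Ideal.Quotient.mkₐ ℂ I) (Ideal.Quotient.mkₐ ℂ J) t)) := by
        intro t
        induction t with
        | zero => simp
        | tmul a b => rfl
        | add a b ha hb => simp only [map_add, ha, hb]
      have h3 : (φ * ψ).ofConv x = LinearMap.mul' ℂ ℂ (TensorProduct.map φ' ψ' (F x)) := h1 _
      rw [h3, show F x = 0 from hx, map_zero, map_zero]

namespace SuperEnveloping

variable (L : Type*) [AddCommGroup L] [Module ℂ L] [LieSuperalgebra L]

theorem isFiniteType_dualMul {φ ψ : SuperEnveloping L →ₗ[ℂ] ℂ} (hφ : IsFiniteType φ)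
    (hψ : IsFiniteType ψ) : IsFiniteType (dualMul φ ψ) := by
  rw [isFiniteType_iff] at *
  obtain ⟨N, hN, h1, h2⟩ := hφ
  obtain ⟨M, hM, h3, h4⟩ := hψ
  let τ : (SuperEnveloping L →ₗ[ℂ] ℂ) →ₗ[ℂ] (SuperEnveloping L →ₗ[ℂ] ℂ) :=
    LinearMap.lcomp ℂ ℂ (twist L 1).toLinearMap
  have hττ : ∀ χ, τ (τ χ) = χ := by
    intro χ
    have := twistDual_twistDual 1 1 χ
    rw [show (1 + 1 : ZMod 2) = 0 by decide, show twistDual 0 χ = χ by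
      ext u; rw [twistDual_apply, twist_zero]; rfl] at this
    exact this
  have htr : ∀ v χ, leftTr v (τ χ) = τ (leftTr (twist L 1 v) χ) := by
    intro v χ
    ext u
    change χ (twist L 1 (v * u)) = χ (twist L 1 v * twist L 1 u)
    rw [map_mul]
  let M' := M ⊔ M.map τ
  have hM' : M'.FG := hM.sup (hM.map τ)
  have hM1 : ∀ v, ∀ χ ∈ M', leftTr v χ ∈ M' := by
    intro v χ hχ
    obtain ⟨a, ha, b, ⟨c, hc, rfl⟩, rfl⟩ := Submodule.mem_sup.mp hχ
    have : leftTr v (a + τ c) = leftTr v a + τ (leftTr (twist L 1 v) c) := by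
      rw [← htr]; rfl
    rw [this]
    exact add_mem (Submodule.mem_sup_left (h4 v a ha))
      (Submodule.mem_sup_right (Submodule.mem_map_of_mem (h4 _ c hc)))
  have hM2 : ∀ i, ∀ χ ∈ M', twistDual i χ ∈ M' := by
    intro i χ hχ
    rcases parity_cases i with rfl | rfl
    · rwa [show twistDual 0 χ = χ by ext u; rw [twistDual_apply, twist_zero]; rfl]
    · obtain ⟨a, ha, b, ⟨c, hc, rfl⟩, rfl⟩ := Submodule.mem_sup.mp hχ
      have : twistDual 1 (a + τ c) = c + τ a := by
        change τ (a + τ c) = c + τ a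
        rw [map_add, hττ, add_comm]
      rw [this]
      exact add_mem (Submodule.mem_sup_left hc)
        (Submodule.mem_sup_right (Submodule.mem_map_of_mem ha))
  let B := LinearMap.mk₂ ℂ (dualMul (L := L)) dualMul_add_left dualMul_smul_left dualMul_add_right
    dualMul_smul_right
  let K := Submodule.map₂ B N M'
  have hK1 : ∀ (k : ZMod 2) (x : L), x ∈ part k → ∀ χ ∈ K, leftTr (ι L x) χ ∈ K := by
    intro k x hx χ hχ
    let D : (SuperEnveloping L →ₗ[ℂ] ℂ) →ₗ[ℂ] (SuperEnveloping L →ₗ[ℂ] ℂ) :=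
      LinearMap.lcomp ℂ ℂ (LinearMap.mulLeft ℂ (ι L x))
    have : K ≤ K.comap D := by
      refine Submodule.map₂_le.mpr fun a ha b hb => ?_
      change leftTr (ι L x) (dualMul a b) ∈ K
      rw [leftTr_dualMul hx]
      exact add_mem (Submodule.apply_mem_map₂ B (h2 _ a ha) (hM2 k b hb))
        (Submodule.apply_mem_map₂ B ha (hM1 _ b hb))
    exact this hχ
  refine ⟨K, hN.map₂ B hM', Submodule.apply_mem_map₂ B h1 (Submodule.mem_sup_left h3), ?_⟩
  intro v
  let P : Submodule ℂ (SuperEnveloping L) :=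
    { carrier := {v | ∀ χ ∈ K, leftTr v χ ∈ K}
      add_mem' := fun {a b} ha hb χ hχ => by
        have : leftTr (a + b) χ = leftTr a χ + leftTr b χ := by
          ext u; simp [leftTr_apply, add_mul]
        rw [this]
        exact add_mem (ha χ hχ) (hb χ hχ)
      zero_mem' := fun χ hχ => by
        have : leftTr 0 χ = 0 := by
          ext u; simp [leftTr_apply]
        rw [this]
        exact zero_mem _
      smul_mem' := fun c a ha χ hχ => by
        have : leftTr (c • a) χ = c • leftTr a χ := by
          ext u; simp [leftTr_apply]
        rw [this]
        exact K.smul_mem c (ha χ hχ) }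
  refine induction_left P ?_ ?_ v
  · intro χ hχ
    have : leftTr 1 χ = χ := by
      ext u; simp [leftTr_apply]
    rwa [this]
  · intro k x hx u hu χ hχ
    have : leftTr (ι L x * u) χ = leftTr u (leftTr (ι L x) χ) := by
      ext w; simp [leftTr_apply, mul_assoc]
    rw [this]
    exact hu _ (hK1 k x hx χ hχ)

/-- The algebra `U(L)° ⊆ U(L)^*` of functionals of finite type on `U(L)`. -/
def finiteDual : Subalgebra ℂ (WithConv (SuperEnveloping L →ₗ[ℂ] ℂ)) where
  carrier := {φ | IsFiniteType φ.ofConv}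
  add_mem' hφ hψ := IsFiniteType.add hφ hψ
  algebraMap_mem' c := isFiniteType_smul_algHom c (counit L)
  mul_mem' hφ hψ := isFiniteType_dualMul L hφ hψ

end SuperEnveloping

end FiniteDual

section Pairs

open WithConv

variable (L : Type*) [AddCommGroup L] [Module ℂ L] [LieSuperalgebra L]

/-- A (graded) subalgebra of a Lie superalgebra. -/
structure LieSubsuperalgebra extends Submodule ℂ L where
  proj_mem' : ∀ (i : ZMod 2) (x : L), x ∈ toSubmodule → LieSuperalgebra.proj L i x ∈ toSubmodule
  bracket_mem' : ∀ x y : L, x ∈ toSubmodule → y ∈ toSubmodule → bracket x y ∈ toSubmodule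

/-- An involution of a Lie superalgebra: an even automorphism `θ` with `θ ∘ θ = id`. -/
structure SuperInvolution extends L →ₗ[ℂ] L where
  map_part' : ∀ (i : ZMod 2) (x : L), x ∈ part i → toLinearMap x ∈ part i
  map_bracket' : ∀ x y : L, toLinearMap (bracket x y) = bracket (toLinearMap x) (toLinearMap y)
  involutive' : ∀ x : L, toLinearMap (toLinearMap x) = x

variable {L}

/-- The subalgebra `𝔨` of fixed points (the `1`-eigenspace) of an involution. -/
def SuperInvolution.fixed (θ : SuperInvolution L) : LieSubsuperalgebra L where
  toSubmodule := LinearMap.ker (θ.toLinearMap - LinearMap.id)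
  proj_mem' i x hx := by
    have hx' : θ.toLinearMap x = x := by simpa [sub_eq_zero] using hx
    have key : ∀ y : L, θ.toLinearMap (LieSuperalgebra.proj L i y) =
        LieSuperalgebra.proj L i (θ.toLinearMap y) := by
      intro y
      refine hom_induction (p := fun y => θ.toLinearMap (LieSuperalgebra.proj L i y) =
        LieSuperalgebra.proj L i (θ.toLinearMap y)) y (fun j y hy => ?_) (fun y z hy hz => ?_)
      · by_cases h : j = i
        · subst h
          rw [LieSuperalgebra.proj_same hy, LieSuperalgebra.proj_same (θ.map_part' j y hy)]
        · rw [LieSuperalgebra.proj_ne hy h, LieSuperalgebra.proj_ne (θ.map_part' j y hy) h,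
            map_zero]
      · simp only [map_add, hy, hz]
    rw [LinearMap.mem_ker, LinearMap.sub_apply, key, hx', LinearMap.id_apply, sub_self]
  bracket_mem' x y hx hy := by
    have hx' : θ.toLinearMap x = x := by simpa [sub_eq_zero] using hx
    have hy' : θ.toLinearMap y = y := by simpa [sub_eq_zero] using hy
    rw [LinearMap.mem_ker, LinearMap.sub_apply, θ.map_bracket', hx', hy', LinearMap.id_apply,
      sub_self]

/-- The `(-1)`-eigenspace `𝔭` of an involution. -/
def SuperInvolution.antifixed (θ : SuperInvolution L) : Submodule ℂ L :=
  LinearMap.ker (θ.toLinearMap + LinearMap.id)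

theorem SuperInvolution.mem_fixed (θ : SuperInvolution L) (x : L) :
    x ∈ θ.fixed.toSubmodule ↔ θ.toLinearMap x = x := by
  simp [SuperInvolution.fixed, sub_eq_zero]

theorem SuperInvolution.mem_antifixed (θ : SuperInvolution L) (x : L) :
    x ∈ θ.antifixed ↔ θ.toLinearMap x = -x := by
  simp [SuperInvolution.antifixed, add_eq_zero_iff_eq_neg]

/-- The centralizer `C_𝔟(𝔞) = {x ∈ 𝔟 | [x, y] = 0 for all y ∈ 𝔞}`. -/
def superCentralizer (b a : Submodule ℂ L) : Submodule ℂ L where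
  carrier := {x | x ∈ b ∧ ∀ y ∈ a, bracket x y = 0}
  add_mem' hx hy := ⟨add_mem hx.1 hy.1, fun z hz => by
    rw [map_add, LinearMap.add_apply, hx.2 z hz, hy.2 z hz, add_zero]⟩
  zero_mem' := ⟨zero_mem _, fun z _ => by rw [map_zero, LinearMap.zero_apply]⟩
  smul_mem' c x hx := ⟨b.smul_mem c hx.1, fun z hz => by
    rw [map_smul, LinearMap.smul_apply, hx.2 z hz, smul_zero]⟩

/-- The operators `ad x`, for `x` in `h`, are simultaneously diagonalizable: `L` has a basis of
common eigenvectors. -/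
def AdSimultaneouslyDiagonalizable (h : Submodule ℂ L) : Prop :=
  ∃ (s : Set L) (b : Module.Basis s ℂ L), ∀ x ∈ h, ∀ i : s, ∃ c : ℂ, bracket x (b i) = c • b i

namespace SuperEnveloping

/-- `U(L) 𝔨`. -/
def leftIdeal (k : LieSubsuperalgebra L) : Submodule ℂ (SuperEnveloping L) :=
  Submodule.span ℂ {w | ∃ x ∈ k.toSubmodule, ∃ u : SuperEnveloping L, w = u * ι L x}

/-- `𝔨 U(L)`. -/
def rightIdeal (k : LieSubsuperalgebra L) : Submodule ℂ (SuperEnveloping L) :=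
  Submodule.span ℂ {w | ∃ x ∈ k.toSubmodule, ∃ u : SuperEnveloping L, w = ι L x * u}

/-- The coideal `𝔨 U(L) + U(L) 𝔨`. -/
def biIdeal (k : LieSubsuperalgebra L) : Submodule ℂ (SuperEnveloping L) :=
  rightIdeal k ⊔ leftIdeal k

theorem biIdeal_le_ker_iff (k : LieSubsuperalgebra L) (φ : SuperEnveloping L →ₗ[ℂ] ℂ) :
    biIdeal k ≤ LinearMap.ker φ ↔
      ∀ x ∈ k.toSubmodule, leftTr (ι L x) φ = 0 ∧ rightTr (ι L x) φ = 0 := by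
  rw [biIdeal, rightIdeal, leftIdeal, sup_le_iff, Submodule.span_le, Submodule.span_le]
  constructor
  · rintro ⟨h1, h2⟩ x hx
    exact ⟨LinearMap.ext fun u => h1 ⟨x, hx, u, rfl⟩, LinearMap.ext fun u => h2 ⟨x, hx, u, rfl⟩⟩
  · intro h
    constructor
    · rintro _ ⟨x, hx, u, rfl⟩
      exact LinearMap.congr_fun (h x hx).1 u
    · rintro _ ⟨x, hx, u, rfl⟩
      exact LinearMap.congr_fun (h x hx).2 u

theorem biIdeal_le_ker_dualMul (k : LieSubsuperalgebra L) {φ ψ : SuperEnveloping L →ₗ[ℂ] ℂ}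
    (hφ : biIdeal k ≤ LinearMap.ker φ) (hψ : biIdeal k ≤ LinearMap.ker ψ) :
    biIdeal k ≤ LinearMap.ker (dualMul φ ψ) := by
  rw [biIdeal_le_ker_iff] at *
  have key : ∀ (i : ZMod 2) (x : L), x ∈ part i → x ∈ k.toSubmodule →
      leftTr (ι L x) (dualMul φ ψ) = 0 ∧ rightTr (ι L x) (dualMul φ ψ) = 0 := by
    intro i x hi hx
    rw [leftTr_dualMul hi, rightTr_dualMul hi, (hφ x hx).1, (hφ x hx).2, (hψ x hx).1, (hψ x hx).2,
      dualMul_zero_left, dualMul_zero_left, dualMul_zero_right, dualMul_zero_right, add_zero]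
    exact ⟨rfl, rfl⟩
  intro x hx
  have h0 := key 0 _ (LieSuperalgebra.proj_mem 0 x) (k.proj_mem' 0 x hx)
  have h1 := key 1 _ (LieSuperalgebra.proj_mem 1 x) (k.proj_mem' 1 x hx)
  rw [← LieSuperalgebra.proj_add_proj x, map_add]
  constructor
  · ext u
    have e0 := LinearMap.congr_fun h0.1 u
    have e1 := LinearMap.congr_fun h1.1 u
    rw [leftTr_apply] at *
    rw [add_mul, map_add, e0, e1]
    simp
  · ext u
    have e0 := LinearMap.congr_fun h0.2 u
    have e1 := LinearMap.congr_fun h1.2 u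
    rw [rightTr_apply] at *
    rw [mul_add, map_add, e0, e1]
    simp

/-- The algebra `𝒜(L, 𝔨)` of `𝔨`-bi-invariant functionals on `U(L)`: those which vanish on
`𝔨 U(L) + U(L) 𝔨`. -/
def biInvariant (k : LieSubsuperalgebra L) :
    Subalgebra ℂ (WithConv (SuperEnveloping L →ₗ[ℂ] ℂ)) where
  carrier := {φ | biIdeal k ≤ LinearMap.ker φ.ofConv}
  add_mem' {φ ψ} hφ hψ := fun u hu => by
    have h1 : φ.ofConv u = 0 := hφ hu
    have h2 : ψ.ofConv u = 0 := hψ hu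
    rw [LinearMap.mem_ker, ofConv_add, LinearMap.add_apply, h1, h2, add_zero]
  algebraMap_mem' c := by
    change biIdeal k ≤ LinearMap.ker (c • (counit L).toLinearMap)
    rw [biIdeal_le_ker_iff]
    intro x _
    constructor <;> ext u
    · simp [leftTr_apply, counit_ι]
    · simp [rightTr_apply, counit_ι]
  mul_mem' hφ hψ := biIdeal_le_ker_dualMul k hφ hψ

/-- The algebra `𝒜(L, 𝔨)° = 𝒜(L, 𝔨) ∩ U(L)°`. -/
def biInvariantFinite (k : LieSubsuperalgebra L) :
    Subalgebra ℂ (WithConv (SuperEnveloping L →ₗ[ℂ] ℂ)) :=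
  biInvariant k ⊓ finiteDual L

end SuperEnveloping

end Pairs

section Symmetrization

variable {V A : Type*} [AddCommGroup V] [Module ℂ V] [Ring A] [Algebra ℂ A]

/-- The multilinear map `(x₁, …, xᵣ) ↦ (1 / r!) ∑_π f x_{π 1} ⋯ f x_{π r}`. -/
def symmetrizedProduct (f : V →ₗ[ℂ] A) (r : ℕ) : MultilinearMap ℂ (fun _ : Fin r => V) A :=
  (r.factorial : ℂ)⁻¹ • ∑ π : Equiv.Perm (Fin r),
    ((MultilinearMap.mkPiAlgebraFin ℂ r A).compLinearMap (fun _ => f)).domDomCongr π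

theorem symmetrizedProduct_apply (f : V →ₗ[ℂ] A) (r : ℕ) (x : Fin r → V) :
    symmetrizedProduct f r x = (r.factorial : ℂ)⁻¹ • ∑ π : Equiv.Perm (Fin r),
      (List.ofFn fun i => f (x (π i))).prod := by
  simp [symmetrizedProduct]

theorem symmetrizedProduct_perm (f : V →ₗ[ℂ] A) (r : ℕ) (x : Fin r → V)
    (σ : Equiv.Perm (Fin r)) :
    symmetrizedProduct f r (fun i => x (σ i)) = symmetrizedProduct f r x := by
  rw [symmetrizedProduct_apply, symmetrizedProduct_apply]
  congr 1
  exact Equiv.sum_comp (Equiv.mulLeft σ)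
    (fun π : Equiv.Perm (Fin r) => (List.ofFn fun i => f (x (π i))).prod)

/-- The symmetrization map on the tensor algebra. -/
def tensorSymmetrization (f : V →ₗ[ℂ] A) : TensorAlgebra ℂ V →ₗ[ℂ] A :=
  (DirectSum.toModule ℂ ℕ A fun r => PiTensorProduct.lift (symmetrizedProduct f r)) ∘ₗ
    TensorAlgebra.toDirectSum.toLinearMap

theorem tensorSymmetrization_tprod (f : V →ₗ[ℂ] A) (r : ℕ) (x : Fin r → V) :
    tensorSymmetrization f (TensorAlgebra.tprod ℂ V r x) = symmetrizedProduct f r x := by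
  rw [tensorSymmetrization, LinearMap.comp_apply, AlgHom.toLinearMap_apply,
    TensorAlgebra.toDirectSum_tensorPower_tprod, ← DirectSum.lof_eq_of ℂ, DirectSum.toModule_lof,
    PiTensorProduct.lift.tprod]

/-- Exchanging two neighbouring factors does not change the symmetrization. -/
theorem tensorSymmetrization_swap (f : V →ₗ[ℂ] A) (x y : V) (a b : TensorAlgebra ℂ V) :
    tensorSymmetrization f (a * (TensorAlgebra.ι ℂ x * TensorAlgebra.ι ℂ y) * b) =
      tensorSymmetrization f (a * (TensorAlgebra.ι ℂ y * TensorAlgebra.ι ℂ x) * b) := by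
  have he : ∀ (n m : ℕ) (e : Fin n ≃ Fin m) (z : Fin m → V),
      symmetrizedProduct f n (fun i => z (e i)) = symmetrizedProduct f m z := by
    intro n m e z
    obtain rfl : n = m := by simpa using Fintype.card_congr e
    exact symmetrizedProduct_perm f n z e
  have hl : ∀ l : List V, tensorSymmetrization f (l.map (TensorAlgebra.ι ℂ)).prod =
      symmetrizedProduct f l.length l.get := by
    intro l
    rw [← tensorSymmetrization_tprod, TensorAlgebra.tprod_apply]
    congr 2
    exact (List.ofFn_getElem_eq_map l (TensorAlgebra.ι ℂ)).symm
  have hp : ∀ l l' : List V, l.Perm l' →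
      tensorSymmetrization f (l.map (TensorAlgebra.ι ℂ)).prod =
      tensorSymmetrization f (l'.map (TensorAlgebra.ι ℂ)).prod := by
    classical
    intro l l' h
    rw [hl, hl, ← he _ _ (Equiv.ofBijective h.idxBij ⟨h.idxBij_injective, h.idxBij_surjective⟩)]
    congr 1
    ext i
    exact (h.getElem_idxBij_eq_getElem i).symm
  have hspan : ∀ t : TensorAlgebra ℂ V, t ∈ Submodule.span ℂ
      (Set.range fun l : List V => (l.map (TensorAlgebra.ι ℂ)).prod) := by
    intro t
    induction t using TensorAlgebra.induction with
    | algebraMap r =>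
      rw [Algebra.algebraMap_eq_smul_one]
      exact Submodule.smul_mem _ _ (Submodule.subset_span ⟨[], by simp⟩)
    | ι z => exact Submodule.subset_span ⟨[z], by simp⟩
    | add s t hs ht => exact add_mem hs ht
    | mul s t hs ht =>
      refine (Submodule.span_mul_span ℂ _ _).le.trans (Submodule.span_mono ?_)
        (Submodule.mul_mem_mul hs ht)
      rintro _ ⟨_, ⟨l, rfl⟩, _, ⟨l', rfl⟩, rfl⟩
      exact ⟨l ++ l', by simp⟩
  induction hspan a using Submodule.span_induction with
  | zero => simp
  | add a a' _ _ h h' => simp only [add_mul, map_add, h, h']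
  | smul c a _ h => simp only [smul_mul_assoc, map_smul, h]
  | mem a ha =>
    obtain ⟨l, rfl⟩ := ha
    induction hspan b using Submodule.span_induction with
    | zero => simp
    | add a a' _ _ h h' => simp only [mul_add, map_add, h, h']
    | smul c a _ h => simp only [mul_smul_comm, map_smul, h]
    | mem b hb =>
      obtain ⟨l', rfl⟩ := hb
      have := hp (l ++ ([x, y] ++ l')) (l ++ ([y, x] ++ l'))
        (((List.Perm.swap y x []).append_right l').append_left l)
      simpa [mul_assoc] using this

/-- The kernel relation of `tensorSymmetrization`, as a ring congruence. -/
def symmetrizationCon (f : V →ₗ[ℂ] A) : RingCon (TensorAlgebra ℂ V) where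
  r s t := ∀ a b, tensorSymmetrization f (a * s * b) = tensorSymmetrization f (a * t * b)
  iseqv := ⟨fun _ _ _ => rfl, fun h a b => (h a b).symm, fun h h' a b => (h a b).trans (h' a b)⟩
  add' h h' a b := by simp only [mul_add, add_mul, map_add, h a b, h' a b]
  mul' {s t s' t'} h h' a b := by
    have h1 := h a (s' * b)
    have h2 := h' (a * t) b
    simp only [mul_assoc] at h1 h2 ⊢
    rw [h1, h2]

theorem symRingCon_le (f : V →ₗ[ℂ] A) :
    TensorAlgebra.symRingCon ℂ V ≤ symmetrizationCon f := by
  unfold TensorAlgebra.symRingCon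
  rw [RingCon.ringConGen_le]
  rintro _ _ ⟨x, y⟩ a b
  exact tensorSymmetrization_swap f x y a b

/-- The symmetrization map `S(V) → A` of a linear map `f : V → A` to an associative algebra:
`x₁ ⋯ xᵣ ↦ (1 / r!) ∑_π f x_{π 1} ⋯ f x_{π r}`. -/
def symmetrization (f : V →ₗ[ℂ] A) : SymmetricAlgebra ℂ V →ₗ[ℂ] A where
  toFun := Quotient.lift (tensorSymmetrization f)
    (fun s t h => by simpa using symRingCon_le f h 1 1)
  map_add' s t := by
    obtain ⟨s, rfl⟩ := SymmetricAlgebra.algHom_surjective ℂ V s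
    obtain ⟨t, rfl⟩ := SymmetricAlgebra.algHom_surjective ℂ V t
    exact (tensorSymmetrization f).map_add s t
  map_smul' c s := by
    obtain ⟨s, rfl⟩ := SymmetricAlgebra.algHom_surjective ℂ V s
    exact (tensorSymmetrization f).map_smul c s

theorem symmetrization_prod (f : V →ₗ[ℂ] A) (r : ℕ) (x : Fin r → V) :
    symmetrization f (∏ i, SymmetricAlgebra.ι ℂ V (x i)) =
      (r.factorial : ℂ)⁻¹ • ∑ π : Equiv.Perm (Fin r), (List.ofFn fun i => f (x (π i))).prod := by
  have h : ∏ i, SymmetricAlgebra.ι ℂ V (x i) =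
      SymmetricAlgebra.algHom ℂ V (TensorAlgebra.tprod ℂ V r x) := by
    rw [TensorAlgebra.tprod_apply, map_list_prod, List.map_ofFn, List.prod_ofFn]
    rfl
  rw [h, ← symmetrizedProduct_apply, ← tensorSymmetrization_tprod]
  rfl

end Symmetrization

section RadialRestriction

open WithConv SuperEnveloping

variable {L : Type*} [AddCommGroup L] [Module ℂ L] [LieSuperalgebra L]

/-- The map `s̄ : S(𝔞) → U(L) / U(L) 𝔨` induced by symmetrization. It is the restriction to
`S(𝔞)` of the super-symmetrization map; all signs are `1` since `𝔞` consists of even elements. -/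
def symmetrizationMod (k : LieSubsuperalgebra L) (a : Submodule ℂ L) :
    SymmetricAlgebra ℂ a →ₗ[ℂ] (SuperEnveloping L ⧸ leftIdeal k) :=
  (leftIdeal k).mkQ ∘ₗ symmetrization (SuperEnveloping.ι L ∘ₗ a.subtype)

/-- The quotient map `q : U(L) / U(L) 𝔨 → U(L) / (𝔨 U(L) + U(L) 𝔨)`. -/
def quotientMap (k : LieSubsuperalgebra L) :
    (SuperEnveloping L ⧸ leftIdeal k) →ₗ[ℂ] (SuperEnveloping L ⧸ biIdeal k) :=
  Submodule.factor le_sup_right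

/-- A bi-invariant functional as a functional on `U(L) / (𝔨 U(L) + U(L) 𝔨)`. -/
def biInvariantDescend (k : LieSubsuperalgebra L) (φ : biInvariant k) :
    (SuperEnveloping L ⧸ biIdeal k) →ₗ[ℂ] ℂ :=
  (biIdeal k).liftQ φ.1.ofConv φ.2

/-- The radial restriction `(q ∘ s̄)^* : 𝒜(L, 𝔨) → S(𝔞)^*`. -/
def radialRestriction (k : LieSubsuperalgebra L) (a : Submodule ℂ L) (φ : biInvariant k) :
    WithConv (SymmetricAlgebra ℂ a →ₗ[ℂ] ℂ) :=
  toConv (biInvariantDescend k φ ∘ₗ quotientMap k ∘ₗ symmetrizationMod k a)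

theorem radialRestriction_prod (k : LieSubsuperalgebra L) (a : Submodule ℂ L) (φ : biInvariant k)
    (r : ℕ) (x : Fin r → a) :
    (radialRestriction k a φ).ofConv (∏ i, SymmetricAlgebra.ι ℂ a (x i)) =
      φ.1.ofConv ((r.factorial : ℂ)⁻¹ • ∑ π : Equiv.Perm (Fin r),
        (List.ofFn fun i => SuperEnveloping.ι L (x (π i) : L)).prod) := by
  have h := symmetrization_prod (SuperEnveloping.ι L ∘ₗ a.subtype) r x
  exact congrArg φ.1.ofConv h

end RadialRestriction

end

/-! Since `C_𝔭(𝔞) = 𝔞`, the even space `𝔞` is abelian, so its inclusion extends to an algebra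
homomorphism `j : S(𝔞) → U(L)`, and symmetrization is `j` itself (`symmetrization_eq_algHom`). The
radial restriction is therefore `φ ↦ φ ∘ j`. It is multiplicative because `j` respects the
coproducts (`dualMul_algHom_apply`), and it preserves finite type because ideals pull back along
`j`. The dual of the cocommutative `S(𝔞)` is commutative, so the commutativity of `𝒜(L, 𝔨)` follows
from injectivity. Injectivity in turn follows from `U(L) = j(S(𝔞)) + 𝓘` with `𝓘 = 𝔨 U(L) + U(L) 𝔨`
(`range_sup_biIdeal_eq_top`), since a bi-invariant functional killing `j(S(𝔞))` then vanishes.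

For this equality, split a homogeneous weight vector `v` of `𝔞` into `x = v + θ v ∈ 𝔨` and `z = v -
θ v ∈ 𝔭`. If the weight `α` is zero, then `z ∈ C_𝔭(𝔞) = 𝔞`; otherwise `[x, h] = -α(h) z` for `h ∈
𝔞`. So `L` is spanned by `𝔞`, `𝔨` and such `z` (`SuperInvolution.span_eq_top`). On `S(𝔞)` the
supercommutator with `x` is, up to lower degree, `g ↦ D(g) z`, where `D` is the derivation extending
`-α`. In characteristic zero `D` is onto, by integration by parts (`exists_superAd_eq`). Hence every
`f z` with `f ∈ S(𝔞)` is a supercommutator with an element of `𝔨` up to lower degree, and `z` can be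
eliminated modulo `𝓘` by induction on the degree (`mul_mem_of_span_eq_top`). Only `α ≠ 0` is used,
whatever the parity of `v`. -/

open LieSuperalgebra

noncomputable section

/-! ### The degree filtration of `U(L)` and supercommutators. -/

namespace SuperEnveloping

variable {L : Type*} [AddCommGroup L] [Module ℂ L] [LieSuperalgebra L]

/-- The span of the products of at most `n` elements of `V` in `U(L)`. -/
def filtration (V : Submodule ℂ L) (n : ℕ) : Submodule ℂ (SuperEnveloping L) :=
  (1 ⊔ V.map (ι L)) ^ n

theorem mul_mem_filtration {V : Submodule ℂ L} {m n : ℕ} {u v : SuperEnveloping L}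
    (hu : u ∈ filtration V m) (hv : v ∈ filtration V n) : u * v ∈ filtration V (m + n) := by
  rw [filtration, pow_add]
  exact Submodule.mul_mem_mul hu hv

theorem filtration_mono (V : Submodule ℂ L) {m n : ℕ} (h : m ≤ n) :
    filtration V m ≤ filtration V n :=
  pow_le_pow_right₀ le_sup_left h

theorem filtration_mono_left {V W : Submodule ℂ L} (h : V ≤ W) (n : ℕ) :
    filtration V n ≤ filtration W n :=
  pow_le_pow_left' (sup_le_sup_left (Submodule.map_mono h) _) n

theorem one_mem_filtration (V : Submodule ℂ L) (n : ℕ) : 1 ∈ filtration V n :=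
  filtration_mono V (Nat.zero_le n) (by rw [filtration, pow_zero]; exact Submodule.one_le.mp le_rfl)

theorem mem_filtration_zero {V : Submodule ℂ L} {u : SuperEnveloping L} :
    u ∈ filtration V 0 ↔ ∃ c : ℂ, u = c • 1 := by
  rw [filtration, pow_zero, Submodule.mem_one]
  simp only [Algebra.algebraMap_eq_smul_one, eq_comm]

theorem ι_mem_filtration {V : Submodule ℂ L} {x : L} (hx : x ∈ V) :
    ι L x ∈ filtration V 1 := by
  rw [filtration, pow_one]
  exact Submodule.mem_sup_right (Submodule.mem_map_of_mem hx)

theorem ι_pow_mem_filtration {V : Submodule ℂ L} {x : L} (hx : x ∈ V) (n : ℕ) :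
    ι L x ^ n ∈ filtration V n := by
  induction n with
  | zero => rw [pow_zero]; exact one_mem_filtration V 0
  | succ n ih => rw [pow_succ]; exact mul_mem_filtration ih (ι_mem_filtration hx)

theorem filtration_succ_le {V : Submodule ℂ L} {n : ℕ} {p : Submodule ℂ (SuperEnveloping L)}
    (h0 : ∀ u ∈ filtration V n, u ∈ p)
    (h1 : ∀ x ∈ V, ∀ u ∈ filtration V n, ι L x * u ∈ p) : filtration V (n + 1) ≤ p := by
  rw [filtration, pow_succ', Submodule.mul_le]
  intro w hw u hu
  obtain ⟨b, hb, _, ⟨x, hx, rfl⟩, rfl⟩ := Submodule.mem_sup.mp hw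
  obtain ⟨c, rfl⟩ := Submodule.mem_one.mp hb
  rw [add_mul, ← Algebra.smul_def]
  exact add_mem (p.smul_mem c (h0 u hu)) (h1 x hx u hu)

theorem exists_mem_filtration (u : SuperEnveloping L) : ∃ n, u ∈ filtration (⊤ : Submodule ℂ L) n := by
  let p : Submodule ℂ (SuperEnveloping L) :=
    { carrier := {u | ∃ n, u ∈ filtration (⊤ : Submodule ℂ L) n}
      add_mem' := fun {u v} ⟨m, hm⟩ ⟨n, hn⟩ => ⟨max m n, add_mem
        (filtration_mono _ (le_max_left m n) hm) (filtration_mono _ (le_max_right m n) hn)⟩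
      zero_mem' := ⟨0, zero_mem _⟩
      smul_mem' := fun c _ ⟨n, hn⟩ => ⟨n, Submodule.smul_mem _ c hn⟩ }
  refine induction_left p ⟨0, one_mem_filtration _ 0⟩ ?_ u
  rintro i x - u ⟨n, hn⟩
  exact ⟨1 + n, mul_mem_filtration (ι_mem_filtration Submodule.mem_top) hn⟩

theorem twist_mem_filtration (i : ZMod 2) {n : ℕ} {u : SuperEnveloping L}
    (hu : u ∈ filtration (⊤ : Submodule ℂ L) n) : twist L i u ∈ filtration (⊤ : Submodule ℂ L) n := by
  induction n generalizing u with
  | zero =>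
    obtain ⟨c, rfl⟩ := mem_filtration_zero.mp hu
    rw [map_smul, map_one]
    exact Submodule.smul_mem _ c (one_mem_filtration _ 0)
  | succ n ih =>
    refine filtration_succ_le (p := (filtration ⊤ (n + 1)).comap (twist L i).toLinearMap)
      (fun u hu => filtration_mono _ n.le_succ (ih hu)) (fun x _ u hu => ?_) hu
    rw [Submodule.mem_comap, AlgHom.toLinearMap_apply, map_mul, twist, lift_ι, add_comm]
    exact mul_mem_filtration (ι_mem_filtration Submodule.mem_top) (ih hu)

theorem twist_of_mem_filtration_even {V : Submodule ℂ L} (hV : V ≤ part 0) (i : ZMod 2) {n : ℕ}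
    {u : SuperEnveloping L} (hu : u ∈ filtration V n) : twist L i u = u := by
  induction n generalizing u with
  | zero =>
    obtain ⟨c, rfl⟩ := mem_filtration_zero.mp hu
    rw [map_smul, map_one]
  | succ n ih =>
    have := filtration_succ_le (p := LinearMap.eqLocus (twist L i).toLinearMap LinearMap.id)
      (fun u hu => ih hu) (fun x hx u hu => ?_) hu
    · exact this
    · change twist L i (ι L x * u) = ι L x * u
      rw [map_mul, twist_ι (hV hx), mul_zero, superSign_zero, one_smul, ih hu]

/-- The supercommutator `u ↦ x u - (-1) ^ (|x| |u|) u x` with an element `x` of parity `i`. -/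
def superAd (i : ZMod 2) (x : L) : SuperEnveloping L →ₗ[ℂ] SuperEnveloping L :=
  LinearMap.mulLeft ℂ (ι L x) - LinearMap.mulRight ℂ (ι L x) ∘ₗ (twist L i).toLinearMap

theorem superAd_apply (i : ZMod 2) (x : L) (u : SuperEnveloping L) :
    superAd i x u = ι L x * u - twist L i u * ι L x := rfl

/-- Carrying the sign by the automorphism `twist` makes the super Leibniz rule valid for all `u` and
`v`, homogeneous or not. -/
theorem superAd_mul (i : ZMod 2) (x : L) (u v : SuperEnveloping L) :
    superAd i x (u * v) = superAd i x u * v + twist L i u * superAd i x v := by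
  simp only [superAd_apply, map_mul]
  noncomm_ring

theorem superAd_one (i : ZMod 2) (x : L) : superAd i x 1 = 0 := by
  simp [superAd_apply]

theorem superAd_ι {i j : ZMod 2} {x y : L} (hx : x ∈ part i) (hy : y ∈ part j) :
    superAd i x (ι L y) = ι L (bracket x y) := by
  rw [superAd_apply, twist_ι hy, smul_mul_assoc, ι_mul_ι hx hy]

/-- Each factor from `L` is replaced by its bracket with `x`, again a single element of `L`. So the
commutator has degree one less than the products it is formed from; every "lower order term" below
arises this way. -/
theorem superAd_mem_filtration {i : ZMod 2} {x : L} (hx : x ∈ part i) {n : ℕ}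
    {u : SuperEnveloping L} (hu : u ∈ filtration (⊤ : Submodule ℂ L) n) :
    superAd i x u ∈ filtration (⊤ : Submodule ℂ L) n := by
  induction n generalizing u with
  | zero =>
    obtain ⟨c, rfl⟩ := mem_filtration_zero.mp hu
    rw [map_smul, superAd_one, smul_zero]
    exact zero_mem _
  | succ n ih =>
    refine filtration_succ_le (p := (filtration ⊤ (n + 1)).comap (superAd i x))
      (fun u hu => filtration_mono _ n.le_succ (ih hu)) (fun y _ u hu => ?_) hu
    -- The bracket formula for `superAd` on `L` needs a definite parity, so `y` is split into
    -- homogeneous parts.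
    refine hom_induction (p := fun y => superAd i x (ι L y * u) ∈ filtration ⊤ (n + 1)) y
      (fun j y hy => ?_) (fun y z hy hz => ?_)
    · rw [superAd_mul, superAd_ι hx hy, twist_ι hy, smul_mul_assoc, add_comm n]
      exact add_mem (mul_mem_filtration (ι_mem_filtration Submodule.mem_top) hu)
        (Submodule.smul_mem _ _ (mul_mem_filtration (ι_mem_filtration Submodule.mem_top) (ih hu)))
    · rw [map_add, add_mul, map_add]
      exact add_mem hy hz

/-! ### Integration: solving `[x, g] ≡ f y` modulo lower degree. -/

section Integration

variable {V : Submodule ℂ L} {i : ZMod 2} {x y : L}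

/-- The twist fixes products of even elements, so for any index `i` this supercommutator is the
ordinary commutator: the error made in moving `y` to the right. -/
theorem ι_mul_of_even (hV : V ≤ part 0) {n : ℕ} {u : SuperEnveloping L}
    (hu : u ∈ filtration V n) : ι L y * u = u * ι L y + superAd i y u := by
  rw [superAd_apply, twist_of_mem_filtration_even hV i hu]
  abel

/-- If `ad x` maps the even subspace `V` to `ℂ y`, then on products of elements of `V` it agrees, up
to terms of lower degree, with a derivation times `y`. -/
theorem exists_superAd_sub_mem (hV : V ≤ part 0) (hx : x ∈ part i) (hy : y ∈ part i)
    (hxV : ∀ h ∈ V, ∃ c : ℂ, bracket x h = c • y) (m : ℕ) {f : SuperEnveloping L}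
    (hf : f ∈ filtration V (m + 1)) :
    ∃ f' ∈ filtration V m, superAd i x f - f' * ι L y ∈ filtration (⊤ : Submodule ℂ L) m := by
  -- The elements `f` admitting such an `f'` form a subspace, so it suffices to treat products `h u`
  -- with `h ∈ V`.
  let p (m : ℕ) : Submodule ℂ (SuperEnveloping L) :=
    { carrier := {f | ∃ f' ∈ filtration V m,
        superAd i x f - f' * ι L y ∈ filtration (⊤ : Submodule ℂ L) m}
      add_mem' := by
        rintro f g ⟨f', hf', hf⟩ ⟨g', hg', hg⟩
        refine ⟨f' + g', add_mem hf' hg', ?_⟩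
        rw [map_add, add_mul, add_sub_add_comm]
        exact add_mem hf hg
      zero_mem' := ⟨0, zero_mem _, by rw [map_zero, zero_mul, sub_zero]; exact zero_mem _⟩
      smul_mem' := by
        rintro c f ⟨f', hf', hf⟩
        refine ⟨c • f', Submodule.smul_mem _ c hf', ?_⟩
        rw [map_smul, smul_mul_assoc, ← smul_sub]
        exact Submodule.smul_mem _ c hf }
  suffices h : filtration V (m + 1) ≤ p m from h hf
  clear hf f
  induction m with
  | zero =>
    refine filtration_succ_le (fun u hu => ?_) (fun h hh u hu => ?_)
    · obtain ⟨c, rfl⟩ := mem_filtration_zero.mp hu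
      refine Submodule.smul_mem _ c ⟨0, zero_mem _, ?_⟩
      rw [superAd_one, zero_mul, sub_zero]
      exact zero_mem _
    · obtain ⟨c, rfl⟩ := mem_filtration_zero.mp hu
      rw [mul_smul_comm, mul_one]
      obtain ⟨d, hd⟩ := hxV h hh
      refine Submodule.smul_mem _ c ⟨d • 1, Submodule.smul_mem _ d (one_mem_filtration _ 0), ?_⟩
      rw [superAd_ι hx (hV hh), hd, map_smul, smul_mul_assoc, one_mul, sub_self]
      exact zero_mem _
  | succ m ih =>
    refine filtration_succ_le (fun u hu => ?_) (fun h hh u hu => ?_)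
    · obtain ⟨f', hf', hu'⟩ := ih hu
      exact ⟨f', filtration_mono _ m.le_succ hf', filtration_mono _ m.le_succ hu'⟩
    · obtain ⟨f', hf', hu'⟩ := ih hu
      obtain ⟨d, hd⟩ := hxV h hh
      -- Leibniz rule for the derivation: `D(h u) = D(h) u + h D(u)` with `D(h) = d` and `D(u) =
      -- f'`. The identity below shows that the error consists of the inherited one and the cost of
      -- moving `y` past `u`.
      refine ⟨d • u + ι L h * f', add_mem (Submodule.smul_mem _ d hu) ?_, ?_⟩
      · rw [add_comm m]
        exact mul_mem_filtration (ι_mem_filtration hh) hf'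
      · have e : superAd i x (ι L h * u) - (d • u + ι L h * f') * ι L y =
            d • superAd i y u + ι L h * (superAd i x u - f' * ι L y) := by
          rw [superAd_mul, superAd_ι hx (hV hh), hd, map_smul, smul_mul_assoc,
            ι_mul_of_even (i := i) hV hu,
            twist_of_mem_filtration_even hV i (ι_mem_filtration hh), add_mul, mul_sub, mul_assoc,
            smul_mul_assoc, smul_add]
          abel
        rw [e]
        refine add_mem (Submodule.smul_mem _ d (superAd_mem_filtration hy
          (filtration_mono_left le_top _ hu))) ?_
        rw [add_comm m]
        exact mul_mem_filtration (ι_mem_filtration Submodule.mem_top) hu'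

/-- The power rule `D(h ^ (s + 1)) = (s + 1) h ^ s` for the derivation with `D(h) = 1`. Each new
factor `h` adds one error, from moving `y` past a power of `h`. -/
theorem superAd_ι_pow_sub_mem (hV : V ≤ part 0) (hx : x ∈ part i) (hy : y ∈ part i) {h : L}
    (hh : h ∈ V) (hxh : bracket x h = y) (s : ℕ) :
    superAd i x (ι L h ^ (s + 1)) - ((s + 1 : ℕ) : ℂ) • (ι L h ^ s * ι L y) ∈
      filtration (⊤ : Submodule ℂ L) s := by
  induction s with
  | zero =>
    rw [zero_add, pow_one, superAd_ι hx (hV hh), hxh]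
    simp
  | succ s ih =>
    have e : superAd i x (ι L h ^ (s + 1 + 1)) -
          ((s + 1 + 1 : ℕ) : ℂ) • (ι L h ^ (s + 1) * ι L y) =
        superAd i y (ι L h ^ (s + 1)) + ι L h * (superAd i x (ι L h ^ (s + 1)) -
          ((s + 1 : ℕ) : ℂ) • (ι L h ^ s * ι L y)) := by
      rw [pow_succ' (ι L h) (s + 1), superAd_mul, superAd_ι hx (hV hh), hxh,
        ι_mul_of_even (i := i) hV (ι_pow_mem_filtration hh (s + 1)),
        twist_of_mem_filtration_even hV i (ι_mem_filtration hh), mul_sub, mul_smul_comm,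
        ← mul_assoc, ← pow_succ', Nat.cast_add (s + 1) 1, add_smul, Nat.cast_one, one_smul]
      abel
    rw [e]
    refine add_mem (superAd_mem_filtration hy (ι_pow_mem_filtration Submodule.mem_top _)) ?_
    rw [show filtration (⊤ : Submodule ℂ L) (s + 1) = filtration ⊤ (1 + s) by rw [add_comm]]
    exact mul_mem_filtration (ι_mem_filtration Submodule.mem_top) ih

/-- Up to terms of lower degree, every `h ^ s f y` is of the form `ad x g`, if `ad x` maps `V` to
`ℂ y` and `[x, h] = y`. -/
theorem exists_superAd_eq (hV : V ≤ part 0) (hx : x ∈ part i) (hy : y ∈ part i)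
    (hxV : ∀ h ∈ V, ∃ c : ℂ, bracket x h = c • y) {h : L} (hh : h ∈ V) (hxh : bracket x h = y)
    (m s : ℕ) {f : SuperEnveloping L} (hf : f ∈ filtration V m) :
    ∃ g ∈ filtration V (m + s + 1),
      superAd i x g - ι L h ^ s * f * ι L y ∈ filtration (⊤ : Submodule ℂ L) (m + s) := by
  have hs : ∀ s : ℕ, ((s + 1 : ℕ) : ℂ) ≠ 0 := fun s => Nat.cast_ne_zero.mpr s.succ_ne_zero
  -- Integration by parts: passing from `f` to its derivative `f'` lowers `m` by one and raises the
  -- exponent `s` by one, so `m + s` is unchanged and the recursion ends when `f` is constant.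
  induction m generalizing s f with
  | zero =>
    obtain ⟨c, rfl⟩ := mem_filtration_zero.mp hf
    refine ⟨(c * ((s + 1 : ℕ) : ℂ)⁻¹) • ι L h ^ (s + 1), Submodule.smul_mem _ _ ?_, ?_⟩
    · rw [zero_add]
      exact ι_pow_mem_filtration hh _
    · have e : superAd i x ((c * ((s + 1 : ℕ) : ℂ)⁻¹) • ι L h ^ (s + 1)) -
            ι L h ^ s * c • 1 * ι L y = (c * ((s + 1 : ℕ) : ℂ)⁻¹) •
          (superAd i x (ι L h ^ (s + 1)) - ((s + 1 : ℕ) : ℂ) • (ι L h ^ s * ι L y)) := by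
        rw [map_smul, smul_sub, smul_smul, mul_assoc c, inv_mul_cancel₀ (hs s), mul_one,
          mul_smul_comm, mul_one, smul_mul_assoc]
      rw [e, zero_add]
      exact Submodule.smul_mem _ _ (superAd_ι_pow_sub_mem hV hx hy hh hxh s)
  | succ m ih =>
    obtain ⟨f', hf', hr⟩ := exists_superAd_sub_mem hV hx hy hxV m hf
    obtain ⟨g', hg', hr'⟩ := ih (s + 1) hf'
    have hp := superAd_ι_pow_sub_mem hV hx hy hh hxh s
    have hpow := ι_pow_mem_filtration hh (s + 1)
    have hfT := filtration_mono_left (le_top (a := V)) _ hf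
    -- From `D(h ^ (s + 1) f) = (s + 1) h ^ s f + h ^ (s + 1) f'`, where `g'` is an integral of the
    -- last term supplied by induction.
    refine ⟨((s + 1 : ℕ) : ℂ)⁻¹ • (ι L h ^ (s + 1) * f - g'),
      Submodule.smul_mem _ _ (sub_mem ?_ ?_), ?_⟩
    · rw [show m + 1 + s + 1 = (s + 1) + (m + 1) by ring]
      exact mul_mem_filtration hpow hf
    · rwa [show m + 1 + s + 1 = m + (s + 1) + 1 by ring]
    -- The four errors come from the power rule, from moving `y` past `f`, from replacing `[x, f]`
    -- by `f' y`, and from `g'`. Each has degree at most `m + 1 + s`.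
    · have e : superAd i x (((s + 1 : ℕ) : ℂ)⁻¹ • (ι L h ^ (s + 1) * f - g')) -
            ι L h ^ s * f * ι L y = ((s + 1 : ℕ) : ℂ)⁻¹ •
          ((superAd i x (ι L h ^ (s + 1)) - ((s + 1 : ℕ) : ℂ) • (ι L h ^ s * ι L y)) * f +
            ((s + 1 : ℕ) : ℂ) • (ι L h ^ s * superAd i y f) +
            ι L h ^ (s + 1) * (superAd i x f - f' * ι L y) -
            (superAd i x g' - ι L h ^ (s + 1) * f' * ι L y)) := by
        have e1 : ι L h ^ s * f * ι L y = ((s + 1 : ℕ) : ℂ)⁻¹ • ((s + 1 : ℕ) : ℂ) •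
            (ι L h ^ s * f * ι L y) := by
          rw [smul_smul, inv_mul_cancel₀ (hs s), one_smul]
        have e2 : superAd i y f = ι L y * f - f * ι L y := by
          rw [ι_mul_of_even (i := i) hV hf]; abel
        rw [e1, map_smul, ← smul_sub]
        congr 1
        rw [map_sub, superAd_mul,
          twist_of_mem_filtration_even hV i hpow, e2]
        simp only [sub_mul, mul_sub, smul_sub, smul_mul_assoc, mul_assoc]
        abel
      rw [e]
      refine Submodule.smul_mem _ _ (sub_mem (add_mem (add_mem ?_ (Submodule.smul_mem _ _ ?_)) ?_) ?_)
      · rw [show m + 1 + s = s + (m + 1) by ring]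
        exact mul_mem_filtration hp hfT
      · rw [show m + 1 + s = s + (m + 1) by ring]
        exact mul_mem_filtration (ι_pow_mem_filtration Submodule.mem_top s) (superAd_mem_filtration hy hfT)
      · rw [show m + 1 + s = (s + 1) + m by ring]
        exact mul_mem_filtration (ι_pow_mem_filtration Submodule.mem_top _) hr
      · rwa [show m + 1 + s = m + (s + 1) by ring]

end Integration

/-! ### Reduction of `U(L)` to `S(𝔞)` modulo the coideal. -/

/-- Products are rewritten with their `𝔞`-part `f` on the left, and the leftmost factor `z` of the
remainder `u` is removed. It is absorbed into `f` if `z ∈ 𝔞`, carried to the right end if `z ∈ 𝔨`,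
and otherwise traded for an element of `𝔨` by integrating `f z`. -/
theorem mul_mem_of_span_eq_top {k : LieSubsuperalgebra L} {a : Submodule ℂ L}
    (ha : a ≤ part 0) {W : Submodule ℂ (SuperEnveloping L)} (hW : biIdeal k ≤ W)
    (haW : ∀ m, filtration a m ≤ W)
    (hspan : Submodule.span ℂ {z : L | z ∈ a ∨ ∃ i, z ∈ part i ∧ (z ∈ k.toSubmodule ∨
      ∃ x ∈ part i, x ∈ k.toSubmodule ∧ (∀ h ∈ a, ∃ c : ℂ, bracket x h = c • z) ∧
        ∃ h ∈ a, bracket x h = z)} = ⊤)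
    (n r m : ℕ) (hmr : m + r ≤ n) {f u : SuperEnveloping L} (hf : f ∈ filtration a m)
    (hu : u ∈ filtration (⊤ : Submodule ℂ L) r) : f * u ∈ W := by
  have hright : ∀ x ∈ k.toSubmodule, ∀ v, ι L x * v ∈ W := fun x hx v =>
    hW (Submodule.mem_sup_left (Submodule.subset_span ⟨x, hx, v, rfl⟩))
  have hleft : ∀ x ∈ k.toSubmodule, ∀ v, v * ι L x ∈ W := fun x hx v =>
    hW (Submodule.mem_sup_right (Submodule.subset_span ⟨x, hx, v, rfl⟩))
  -- The outer induction is on a bound `n` for the total degree, the inner one on the degree `r` of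
  -- the part not yet known to lie in `S(𝔞)`.
  induction n using Nat.strong_induction_on generalizing r m f u with
  | _ n ihn =>
  induction r generalizing m f u with
  | zero =>
    obtain ⟨c, rfl⟩ := mem_filtration_zero.mp hu
    rw [mul_smul_comm, mul_one]
    exact W.smul_mem c (haW m hf)
  | succ r ihr =>
    refine filtration_succ_le (p := W.comap (LinearMap.mulLeft ℂ f))
      (fun u hu => ihr m (by omega) hf hu) (fun z hzT u hu => ?_) hu
    clear hzT
    rw [Submodule.mem_comap, LinearMap.mulLeft_apply]
    have hz : z ∈ Submodule.span ℂ _ := hspan ▸ Submodule.mem_top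
    induction hz using Submodule.span_induction with
    | zero => rw [map_zero, zero_mul, mul_zero]; exact zero_mem _
    | add z w _ _ hz hw => rw [map_add, add_mul, mul_add]; exact add_mem hz hw
    | smul c z _ hz =>
      rw [map_smul, smul_mul_assoc, mul_smul_comm]; exact W.smul_mem c hz
    | mem z hz =>
      rcases hz with hz | ⟨i, hzi, hz | ⟨x, hxi, hxk, hxa, h, hh, hxh⟩⟩
      · rw [← mul_assoc]
        exact ihr (m + 1) (by omega) (mul_mem_filtration hf (ι_mem_filtration hz)) hu
      -- With `z ∈ 𝔨` moved to the right end the product lies in `U(L) 𝔨`; the commutator with `u`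
      -- has degree only `r`.
      · have e : f * (ι L z * u) = f * twist L i u * ι L z + f * superAd i z u := by
          rw [superAd_apply]; noncomm_ring
        rw [e]
        exact add_mem (hleft z hz _) (ihr m (by omega) hf (superAd_mem_filtration hzi hu))
      -- Here `z = [x, h]` with `x ∈ 𝔨`; the integral `g` of `f z` has degree `m + 1`, and no extra
      -- power of `h` is needed, so `s = 0`.
      · obtain ⟨g, hg, hr⟩ := exists_superAd_eq ha hxi hzi hxa hh hxh m 0 hf
        rw [pow_zero, one_mul] at hr
        have e : f * (ι L z * u) = superAd i x (g * u) - g * superAd i x u -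
            1 * ((superAd i x g - f * ι L z) * u) := by
          rw [superAd_mul, twist_of_mem_filtration_even ha i hg]; noncomm_ring
        rw [e]
        refine sub_mem (sub_mem ?_ (ihr (m + 1) (by omega) hg (superAd_mem_filtration hxi hu))) ?_
        -- A supercommutator with `x ∈ 𝔨` lies in `𝔨 U(L) + U(L) 𝔨`.
        · rw [superAd_apply]
          exact sub_mem (hright x hxk _) (hleft x hxk _)
        -- The lower order error need not have its `𝔞`-part on the left, so it is treated as a
        -- remainder of degree `m + r` with left factor `1`. This may exceed `r`, which is why the
        -- outer induction on total degree is needed.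
        · exact ihn (m + r) (by omega) (m + r) 0 (by omega) (one_mem_filtration a 0)
            (mul_mem_filtration hr hu)

end SuperEnveloping

/-! ### A spanning set of `L` from weight vectors of `𝔞`. -/

section WeightVectors

variable {L : Type*} [AddCommGroup L] [Module ℂ L] [LieSuperalgebra L]

/-- Used to see that the homogeneous components of a common eigenvector of `𝔞` are again
eigenvectors for the same weight. -/
theorem LieSuperalgebra.bracket_proj_of_even {x : L} (hx : x ∈ part 0) (i : ZMod 2) (y : L) :
    bracket x (LieSuperalgebra.proj L i y) = LieSuperalgebra.proj L i (bracket x y) := by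
  refine hom_induction (p := fun y => bracket x (LieSuperalgebra.proj L i y) =
    LieSuperalgebra.proj L i (bracket x y)) y (fun j y hy => ?_) (fun y z hy hz => ?_)
  · have hb := bracket_mem 0 j x y hx hy
    rw [zero_add] at hb
    by_cases h : j = i
    · subst h
      rw [LieSuperalgebra.proj_same hy, LieSuperalgebra.proj_same hb]
    · rw [LieSuperalgebra.proj_ne hy h, LieSuperalgebra.proj_ne hb h, map_zero]
  · simp only [map_add, hy, hz]

/-- As `θ` is `-1` on `𝔞`, it sends a vector of weight `α` to one of weight `-α`. Hence `ad h`, for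
`h ∈ 𝔞`, exchanges `v + θ v ∈ 𝔨` and `v - θ v ∈ 𝔭` up to the factor `α(h)`. -/
theorem SuperInvolution.mem_span_of_weight (θ : SuperInvolution L) {a : Submodule ℂ L}
    (ha0 : a ≤ part 0) (ha : a ≤ θ.antifixed) (hca : superCentralizer θ.antifixed a = a)
    {i : ZMod 2} {v : L} (hv : v ∈ part i)
    (hav : ∀ h ∈ a, ∃ c : ℂ, bracket h v = c • v) :
    v ∈ Submodule.span ℂ {z : L | z ∈ a ∨ ∃ i, z ∈ part i ∧ (z ∈ θ.fixed.toSubmodule ∨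
      ∃ x ∈ part i, x ∈ θ.fixed.toSubmodule ∧ (∀ h ∈ a, ∃ c : ℂ, bracket x h = c • z) ∧
        ∃ h ∈ a, bracket x h = z)} := by
  have hθv := θ.map_part' i v hv
  have hskew : ∀ h ∈ a, ∀ y ∈ part (L := L) i, bracket y h = -bracket h y := by
    intro h hh y hy
    rw [skew i 0 y h hy (ha0 hh), mul_zero, superSign_zero, one_smul]
  have hθ : ∀ h ∈ a, ∀ c : ℂ, bracket h v = c • v →
      bracket h (θ.toLinearMap v) = -(c • θ.toLinearMap v) := by
    intro h hh c hc
    have := θ.map_bracket' h v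
    rw [hc, map_smul, (θ.mem_antifixed h).mp (ha hh), map_neg, LinearMap.neg_apply] at this
    rw [this, neg_neg]
  have hx : v + θ.toLinearMap v ∈ θ.fixed.toSubmodule := by
    rw [θ.mem_fixed, map_add, θ.involutive', add_comm]
  have hz : v - θ.toLinearMap v ∈ θ.antifixed := by
    rw [θ.mem_antifixed, map_sub, θ.involutive', neg_sub]
  have hxz : ∀ h ∈ a, ∀ c : ℂ, bracket h v = c • v →
      bracket (v + θ.toLinearMap v) h = (-c) • (v - θ.toLinearMap v) := by
    intro h hh c hc
    rw [hskew h hh _ (add_mem hv hθv), map_add, hc, hθ h hh c hc]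
    module
  have e : v = (2⁻¹ : ℂ) • (v + θ.toLinearMap v) + (2⁻¹ : ℂ) • (v - θ.toLinearMap v) := by
    module
  rw [e]
  refine add_mem (Submodule.smul_mem _ _ (Submodule.subset_span
    (Or.inr ⟨i, add_mem hv hθv, Or.inl hx⟩))) (Submodule.smul_mem _ _ (Submodule.subset_span ?_))
  -- Weight zero puts `v - θ v` into `C_𝔭(𝔞) = 𝔞`; for nonzero weight, an `h` on which the weight
  -- does not vanish is rescaled so that `[v + θ v, h] = v - θ v`.
  by_cases h0 : ∀ h ∈ a, bracket h v = 0
  · left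
    rw [← hca]
    refine ⟨hz, fun h hh => ?_⟩
    have := hθ h hh 0 (by rw [h0 h hh, zero_smul])
    rw [hskew h hh _ (sub_mem hv hθv), map_sub, h0 h hh, this, zero_smul]
    simp
  · right
    push Not at h0
    obtain ⟨h, hh, hne⟩ := h0
    obtain ⟨c, hc⟩ := hav h hh
    have hc0 : c ≠ 0 := by
      rintro rfl
      exact hne (by rw [hc, zero_smul])
    refine ⟨i, sub_mem hv hθv, Or.inr ⟨_, add_mem hv hθv, hx, fun h' hh' => ?_,
      (-c)⁻¹ • h, a.smul_mem _ hh, ?_⟩⟩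
    · obtain ⟨d, hd⟩ := hav h' hh'
      exact ⟨-d, hxz h' hh' d hd⟩
    · rw [map_smul, hxz h hh c hc, smul_smul, inv_mul_cancel₀ (neg_ne_zero.mpr hc0), one_smul]

theorem SuperInvolution.span_eq_top (θ : SuperInvolution L) {h a : Submodule ℂ L}
    (hh0 : h ≤ part 0) (hdiag : AdSimultaneouslyDiagonalizable h) (hah : a ≤ h)
    (ha : a ≤ θ.antifixed) (hca : superCentralizer θ.antifixed a = a) :
    Submodule.span ℂ {z : L | z ∈ a ∨ ∃ i, z ∈ part i ∧ (z ∈ θ.fixed.toSubmodule ∨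
      ∃ x ∈ part i, x ∈ θ.fixed.toSubmodule ∧ (∀ h ∈ a, ∃ c : ℂ, bracket x h = c • z) ∧
        ∃ h ∈ a, bracket x h = z)} = ⊤ := by
  obtain ⟨s, b, hb⟩ := hdiag
  rw [eq_top_iff, ← b.span_eq, Submodule.span_le]
  rintro _ ⟨j, rfl⟩
  rw [SetLike.mem_coe, ← LieSuperalgebra.proj_add_proj (b j)]
  have key : ∀ i : ZMod 2, ∀ x ∈ a, ∃ c : ℂ, bracket x (LieSuperalgebra.proj L i (b j)) =
      c • LieSuperalgebra.proj L i (b j) := by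
    intro i x hx
    obtain ⟨c, hc⟩ := hb x (hah hx) j
    exact ⟨c, by rw [bracket_proj_of_even (hh0 (hah hx)), hc, map_smul]⟩
  exact add_mem
    (θ.mem_span_of_weight (hah.trans hh0) ha hca (LieSuperalgebra.proj_mem 0 _) (key 0))
    (θ.mem_span_of_weight (hah.trans hh0) ha hca (LieSuperalgebra.proj_mem 1 _) (key 1))

end WeightVectors

/-! ### Symmetrization and convolution for commuting images; pullback of finite type. -/

namespace SymmetricAlgebra

variable {V A : Type*} [AddCommGroup V] [Module ℂ V] [Ring A] [Algebra ℂ A]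

theorem span_range_list_prod :
    Submodule.span ℂ (Set.range fun l : List V => (l.map (ι ℂ V)).prod) = ⊤ := by
  rw [eq_top_iff]
  rintro s -
  induction s using SymmetricAlgebra.induction with
  | algebraMap r =>
    rw [Algebra.algebraMap_eq_smul_one]
    exact Submodule.smul_mem _ _ (Submodule.subset_span ⟨[], by simp⟩)
  | ι z => exact Submodule.subset_span ⟨[z], by simp⟩
  | add s t hs ht => exact add_mem hs ht
  | mul s t hs ht =>
    refine (Submodule.span_mul_span ℂ _ _).le.trans (Submodule.span_mono ?_)
      (Submodule.mul_mem_mul hs ht)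
    rintro _ ⟨_, ⟨l, rfl⟩, _, ⟨l', rfl⟩, rfl⟩
    exact ⟨l ++ l', by simp⟩

theorem linearMap_ext_list {M : Type*} [AddCommGroup M] [Module ℂ M]
    {f g : SymmetricAlgebra ℂ V →ₗ[ℂ] M}
    (h : ∀ l : List V, f (l.map (ι ℂ V)).prod = g (l.map (ι ℂ V)).prod) : f = g :=
  LinearMap.ext_on_range span_range_list_prod h

/-- The universal property of the symmetric algebra needs a commutative target, so the map is
factored through the subalgebra generated by the commuting image. -/
theorem exists_algHom_of_commute (f : V →ₗ[ℂ] A) (hf : ∀ x y, f x * f y = f y * f x) :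
    ∃ j : SymmetricAlgebra ℂ V →ₐ[ℂ] A, ∀ x, j (ι ℂ V x) = f x := by
  have hcomm : ∀ x ∈ Set.range f, ∀ y ∈ Set.range f, x * y = y * x := by
    rintro _ ⟨x, rfl⟩ _ ⟨y, rfl⟩
    exact hf x y
  have := Algebra.isMulCommutative_adjoin ℂ hcomm
  let : CommRing (Algebra.adjoin ℂ (Set.range f)) :=
    { (inferInstance : Ring (Algebra.adjoin ℂ (Set.range f))) with
      mul_comm := fun x y => mul_comm' x y }
  let g : V →ₗ[ℂ] Algebra.adjoin ℂ (Set.range f) :=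
    f.codRestrict (Subalgebra.toSubmodule (Algebra.adjoin ℂ (Set.range f)))
      (fun x => Algebra.subset_adjoin ⟨x, rfl⟩)
  refine ⟨(Algebra.adjoin ℂ (Set.range f)).val.comp (lift g), fun x => ?_⟩
  rw [AlgHom.comp_apply, lift_ι_apply]
  rfl

/-- All `r!` reordered products are the image of the same monomial, so averaging them changes
nothing. -/
theorem symmetrization_eq_algHom (f : V →ₗ[ℂ] A) (j : SymmetricAlgebra ℂ V →ₐ[ℂ] A)
    (hj : ∀ x, j (ι ℂ V x) = f x) : symmetrization f = j.toLinearMap := by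
  refine linearMap_ext_list fun l => ?_
  rw [← Fin.prod_univ_fun_getElem, symmetrization_prod, AlgHom.toLinearMap_apply]
  have h : ∀ π : Equiv.Perm (Fin l.length), (List.ofFn fun i : Fin l.length => f l[π i]).prod =
      j (∏ i : Fin l.length, ι ℂ V l[i]) := by
    intro π
    rw [← Equiv.prod_comp π, ← List.prod_ofFn, map_list_prod, List.map_ofFn]
    congr 2
    ext i
    exact (hj _).symm
  refine (congrArg _ (Finset.sum_congr rfl fun π _ => h π)).trans ?_
  rw [Finset.sum_const, Finset.card_univ, Fintype.card_perm, Fintype.card_fin,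
    ← Nat.cast_smul_eq_nsmul ℂ, smul_smul,
    inv_mul_cancel₀ (Nat.cast_ne_zero.mpr (Nat.factorial_ne_zero _)), one_smul]
  rfl

/-- The left translation by a primitive element is a derivation of the convolution product; this is
the counterpart in `S(V)` of `leftTr_dualMul`. -/
theorem convolution_ι_mul (φ ψ : SymmetricAlgebra ℂ V →ₗ[ℂ] ℂ) (x : V)
    (s : SymmetricAlgebra ℂ V) :
    LinearMap.mul' ℂ ℂ (TensorProduct.map φ ψ (Coalgebra.comul (R := ℂ) (ι ℂ V x * s))) =
      LinearMap.mul' ℂ ℂ (TensorProduct.map (φ ∘ₗ LinearMap.mulLeft ℂ (ι ℂ V x)) ψ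
        (Coalgebra.comul (R := ℂ) s)) +
      LinearMap.mul' ℂ ℂ (TensorProduct.map φ (ψ ∘ₗ LinearMap.mulLeft ℂ (ι ℂ V x))
        (Coalgebra.comul (R := ℂ) s)) := by
  rw [Bialgebra.comul_mul, comul_ι]
  induction Coalgebra.comul (R := ℂ) s with
  | zero => simp
  | tmul u v => simp [add_mul]
  | add t t' ht ht' =>
    simp only [mul_add, map_add, ht, ht']
    ring

end SymmetricAlgebra

/-- If `φ` vanishes on `I`, then `φ ∘ j` vanishes on the preimage of `I`, and the quotient by that
preimage embeds in `H ⧸ I`. -/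
theorem IsFiniteType.comp_algHom {H K : Type*} [Ring H] [Algebra ℂ H] [Ring K] [Algebra ℂ K]
    {φ : H →ₗ[ℂ] ℂ} (hφ : IsFiniteType φ) (j : K →ₐ[ℂ] H) : IsFiniteType (φ ∘ₗ j.toLinearMap) := by
  obtain ⟨I, hI, hfin, h⟩ := hφ
  have hfin' : FiniteDimensional ℂ (H ⧸ I.restrictScalars ℂ) := hfin
  refine ⟨I.comap j, inferInstance, ?_, fun x hx => h _ hx⟩
  have he : (I.comap j).restrictScalars ℂ =
      LinearMap.ker ((I.restrictScalars ℂ).mkQ ∘ₗ j.toLinearMap) := by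
    rw [LinearMap.ker_comp, Submodule.ker_mkQ]
    rfl
  have h2 : FiniteDimensional ℂ (K ⧸ (I.comap j).restrictScalars ℂ) := by
    rw [he]
    exact finite_quot_ker _
  exact h2

/-! ### The radial restriction as pullback along `S(𝔞) → U(L)`. -/

section RadialRestriction

open WithConv SuperEnveloping

variable {L : Type*} [AddCommGroup L] [Module ℂ L] [LieSuperalgebra L]

/-- Both products take the same value at `1`, and left translation by `x ∈ 𝔞` obeys the same Leibniz
rule for both: the sign in `U(L)` disappears because `x` is even. Induction on the length of a
monomial gives the equality. -/
theorem SuperEnveloping.dualMul_algHom_apply {a : Submodule ℂ L} (ha : a ≤ part 0)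
    (j : SymmetricAlgebra ℂ a →ₐ[ℂ] SuperEnveloping L)
    (hj : ∀ x, j (SymmetricAlgebra.ι ℂ a x) = SuperEnveloping.ι L x)
    (φ ψ : SuperEnveloping L →ₗ[ℂ] ℂ) :
    toConv (dualMul φ ψ ∘ₗ j.toLinearMap) =
      toConv (φ ∘ₗ j.toLinearMap) * toConv (ψ ∘ₗ j.toLinearMap) := by
  refine congrArg toConv (SymmetricAlgebra.linearMap_ext_list fun l => ?_)
  change dualMul φ ψ (j _) = LinearMap.mul' ℂ ℂ (TensorProduct.map (φ ∘ₗ j.toLinearMap)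
    (ψ ∘ₗ j.toLinearMap) (Coalgebra.comul (R := ℂ) _))
  induction l generalizing φ ψ with
  | nil =>
    rw [List.map_nil, List.prod_nil, map_one, dualMul_one, Bialgebra.comul_one]
    simp [Algebra.TensorProduct.one_def]
  | cons x l ih =>
    have hl : ∀ χ : SuperEnveloping L →ₗ[ℂ] ℂ, (χ ∘ₗ j.toLinearMap) ∘ₗ
        LinearMap.mulLeft ℂ (SymmetricAlgebra.ι ℂ a x) =
        leftTr (SuperEnveloping.ι L x) χ ∘ₗ j.toLinearMap := by
      intro χ
      ext s
      simp [leftTr_apply, hj]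
    have h0 : twistDual 0 ψ = ψ := by
      ext u
      rw [twistDual_apply, twist_zero]
      rfl
    rw [List.map_cons, List.prod_cons, SymmetricAlgebra.convolution_ι_mul, hl, hl, ← ih, ← ih,
      map_mul, hj, ← leftTr_apply, leftTr_dualMul (ha x.2), h0]
    rfl

theorem SuperEnveloping.filtration_le_range {a : Submodule ℂ L}
    (j : SymmetricAlgebra ℂ a →ₐ[ℂ] SuperEnveloping L)
    (hj : ∀ x, j (SymmetricAlgebra.ι ℂ a x) = SuperEnveloping.ι L x) (m : ℕ) :
    filtration a m ≤ LinearMap.range j.toLinearMap := by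
  induction m with
  | zero =>
    intro u hu
    obtain ⟨c, rfl⟩ := mem_filtration_zero.mp hu
    exact Submodule.smul_mem _ c ⟨1, map_one j⟩
  | succ m ih =>
    refine filtration_succ_le ih fun x hx u hu => ?_
    obtain ⟨s, rfl⟩ := ih hu
    exact ⟨SymmetricAlgebra.ι ℂ a ⟨x, hx⟩ * s, by simp [hj]⟩

/-- Every element of `U(L)` is congruent to an element of `S(𝔞)` modulo `𝔨 U(L) + U(L) 𝔨`. -/
theorem SuperEnveloping.range_sup_biIdeal_eq_top (θ : SuperInvolution L) {h a : Submodule ℂ L}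
    (hh0 : h ≤ part 0) (hdiag : AdSimultaneouslyDiagonalizable h) (hah : a ≤ h)
    (ha : a ≤ θ.antifixed) (hca : superCentralizer θ.antifixed a = a)
    (j : SymmetricAlgebra ℂ a →ₐ[ℂ] SuperEnveloping L)
    (hj : ∀ x, j (SymmetricAlgebra.ι ℂ a x) = SuperEnveloping.ι L x) :
    LinearMap.range j.toLinearMap ⊔ biIdeal θ.fixed = ⊤ := by
  rw [eq_top_iff]
  rintro u -
  obtain ⟨n, hn⟩ := exists_mem_filtration u
  -- The reduction is applied to `u` with left factor `1`, of degree `0`.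
  have := mul_mem_of_span_eq_top (hah.trans hh0) le_sup_right
    (fun m => (filtration_le_range j hj m).trans le_sup_left)
    (θ.span_eq_top hh0 hdiag hah ha hca) n n 0 (zero_add n).le (one_mem_filtration a 0) hn
  rwa [one_mul] at this

theorem radialRestriction_eq_comp (k : LieSubsuperalgebra L) {a : Submodule ℂ L}
    (j : SymmetricAlgebra ℂ a →ₐ[ℂ] SuperEnveloping L)
    (hj : ∀ x, j (SymmetricAlgebra.ι ℂ a x) = SuperEnveloping.ι L x) (φ : biInvariant k) :
    radialRestriction k a φ = toConv (φ.1.ofConv ∘ₗ j.toLinearMap) := by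
  rw [← SymmetricAlgebra.symmetrization_eq_algHom (SuperEnveloping.ι L ∘ₗ a.subtype) j hj]
  rfl

end RadialRestriction

end

/-! ### The homomorphism, its injectivity and the finite-type restriction. -/

theorem theorem3p9 {L : Type*} [AddCommGroup L] [Module ℂ L] [LieSuperalgebra L]
    (θ : SuperInvolution L) (h : LieSubsuperalgebra L)
    (h_even : h.toSubmodule ≤ LieSuperalgebra.part 0)
    (h_stable : h.toSubmodule.map θ.toLinearMap = h.toSubmodule)
    (h_diag : AdSimultaneouslyDiagonalizable h.toSubmodule)
    (a : Submodule ℂ L) (ha : a = h.toSubmodule ⊓ θ.antifixed)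
    (h_centralizer : superCentralizer ⊤ h.toSubmodule = h.toSubmodule)
    (a_centralizer : superCentralizer θ.antifixed a = a) :
    (∀ φ ψ : SuperEnveloping.biInvariant θ.fixed, φ * ψ = ψ * φ) ∧
    ∃ F : SuperEnveloping.biInvariant θ.fixed →ₐ[ℂ] WithConv (SymmetricAlgebra ℂ a →ₗ[ℂ] ℂ),
      (∀ φ, F φ = radialRestriction θ.fixed a φ) ∧ Function.Injective F ∧
      ∃ F' : SuperEnveloping.biInvariantFinite θ.fixed →ₐ[ℂ] finiteDual (SymmetricAlgebra ℂ a),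
        (∀ φ : SuperEnveloping.biInvariantFinite θ.fixed, (F' φ : WithConv (SymmetricAlgebra ℂ a →ₗ[ℂ] ℂ)) =
          F ⟨φ.1, φ.2.1⟩) ∧ Function.Injective F' := by
  have hah : a ≤ h.toSubmodule := ha ▸ inf_le_left
  have hap : a ≤ θ.antifixed := ha ▸ inf_le_right
  have ha0 : a ≤ LieSuperalgebra.part 0 := hah.trans h_even
  obtain ⟨j, hj⟩ := SymmetricAlgebra.exists_algHom_of_commute
    (SuperEnveloping.ι L ∘ₗ a.subtype) (fun x y => by
      have h1 := SuperEnveloping.ι_mul_ι (ha0 x.2) (ha0 y.2)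
      -- The inclusion `𝔞 ⊆ C_𝔭(𝔞)` says that `𝔞` is abelian, so its elements commute in `U(L)`.
      have hx : (x : L) ∈ superCentralizer θ.antifixed a := a_centralizer.symm ▸ x.2
      rw [hx.2 y y.2, map_zero, mul_zero, superSign_zero, one_smul, sub_eq_zero] at h1
      exact h1)
  have hr := radialRestriction_eq_comp θ.fixed j hj
  let F : SuperEnveloping.biInvariant θ.fixed →ₐ[ℂ] WithConv (SymmetricAlgebra ℂ a →ₗ[ℂ] ℂ) :=
    AlgHom.ofLinearMap
      { toFun := radialRestriction θ.fixed a
        map_add' := fun φ ψ => by simp only [hr]; rfl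
        map_smul' := fun c φ => by simp only [hr]; rfl }
      (by
        refine (hr 1).trans (congrArg WithConv.toConv
          (SymmetricAlgebra.linearMap_ext_list fun l => ?_))
        change SuperEnveloping.counit L (j _) = Bialgebra.counitAlgHom ℂ _ _
        have hc : (SuperEnveloping.counit L).comp j =
            Bialgebra.counitAlgHom ℂ (SymmetricAlgebra ℂ a) := by
          refine SymmetricAlgebra.algHom_ext (LinearMap.ext fun x => ?_)
          simp [hj, SuperEnveloping.counit_ι, SymmetricAlgebra.algebraMapInv_ι]
        exact DFunLike.congr_fun hc _)
      (fun φ ψ => by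
        change radialRestriction θ.fixed a (φ * ψ) =
          radialRestriction θ.fixed a φ * radialRestriction θ.fixed a ψ
        rw [hr, hr, hr]
        exact SuperEnveloping.dualMul_algHom_apply ha0 j hj _ _)
  have hF : ∀ φ, F φ = radialRestriction θ.fixed a φ := fun _ => rfl
  have hinj : Function.Injective F := by
    rw [injective_iff_map_eq_zero]
    intro φ hφ
    rw [hF, hr] at hφ
    have hφj : ∀ s, φ.1.ofConv (j s) = 0 := fun s =>
      LinearMap.congr_fun (WithConv.toConv_injective (hφ.trans WithConv.toConv_zero.symm)) s
    -- The functional vanishes on the image of `S(𝔞)` by assumption and on the coideal by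
    -- bi-invariance, and these span `U(L)`.
    have hker : (⊤ : Submodule ℂ (SuperEnveloping L)) ≤ LinearMap.ker φ.1.ofConv := by
      rw [← SuperEnveloping.range_sup_biIdeal_eq_top θ h_even h_diag hah hap a_centralizer j hj]
      refine sup_le ?_ φ.2
      rintro _ ⟨s, rfl⟩
      exact hφj s
    exact Subtype.ext (WithConv.ofConv_injective (LinearMap.ext fun u => hker trivial))
  -- Commutativity is pulled back along the injective `F` from the commutative algebra `S(𝔞)^*`.
  refine ⟨fun φ ψ => hinj (by rw [map_mul, map_mul, mul_comm]), F, hF, hinj, ?_⟩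
  refine ⟨(F.comp (Subalgebra.inclusion inf_le_left)).codRestrict _ (fun φ => ?_), fun _ => rfl,
    fun φ ψ hφψ => ?_⟩
  · change IsFiniteType (radialRestriction θ.fixed a ⟨φ.1, φ.2.1⟩).ofConv
    rw [hr]
    exact IsFiniteType.comp_algHom φ.2.2 j
  · exact Subtype.ext (congrArg (fun χ => χ.1) (hinj (congrArg Subtype.val hφψ)))
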